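/- For positive integers $m,p,r$ with $p\mid m$ let $G(m,p,r)\subset \mathrm{GL}_r(\mathbb C)$ be the group of monomial $r\times r$ matrices whose nonzero entries are $m$-th roots of unity and such that the product of the nonzero entries is an $(m/p)$-th root of unity. It acts on $V=\mathbb C^r$ and on the ring $S(V^*)=\mathbb C[x_1,\dots,x_r]$ of polynomial functions on $V$. Let $r,a,b,d,e$ be positive integers with $a=de$, and put $G=G(ab,b,r)$ and $N=G(ab,db,r)$. Let $\zeta_{ab}\in\mathbb C$ be a primitive $ab$-th root of unity, let $1\le s<ab$ with $\gcd(s,ab)=1$, and let $\sigma\in\mathrm{Gal}(\mathbb Q(\zeta_{ab})/\mathbb Q)$ be given by $\sigma(\zeta_{ab})=\zeta_{ab}^s$. We use the following notation. * $V^\sigma$ is the Galois twist of $V$: the $G$-module $\mathbb C^r$ on which $g\in G$ acts by the matrix obtained by applying $\sigma$ to the entries of $g$. * $\mathcal C_N\subset S(V^*)$ is the space of $N$-harmonic polynomials, i.e. of the polynomials annihilated by all $N$-invariant polynomial (constant-coefficient) differential operators without constant term. As $N$ is normal in $G$, it is $G$-stable. * $U^N_\sigma$ (the Orlik–Solomon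 space) is the $G$-module dual to $(U^N_\sigma)^*:=(\mathcal C_N\otimes (V^\sigma)^*)^N$. * $E=V/N$ is the $G$-module dual to $E^*=\mathrm{span}_{\mathbb C}\{N_1,\dots,N_r\}$, where $N_1,\dots,N_r$ are homogeneous algebraically independent generators of the invariant ring $S(V^*)^N$ whose span is $G$-stable. * For $n\in\mathbb Z$ and a $G$-module $\rho:G\to\mathrm{GL}(W)$, the fake tensor power $W^{\boxtimes n}$ is the $G$-module $\rho\circ\mu_n$, where $\mu_n:G\to G$ is the endomorphism raising each nonzero matrix entry to the $n$-th power. Then $N$ is a normal subgroup of $G$, the quotient $H=G/N$ is isomorphic to the cyclic group $C_d$ of order $d$, generators $N_1,\dots,N_r$ as above exist, and for every choice of them $$U^N_\sigma\;\simeq\;E^{\boxtimes\lceil s/e\rceil}\qquad\text{as } G\text{-modules.}$$ -/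

import Mathlib

open MvPolynomial

noncomputable section

/-- The group `G(m, p, r)` (for `p ∣ m`) in its standard reflection representation: the monomial
`r × r` matrices (in column `j` the only nonzero entry is `θ j`, in row `π j`) whose nonzero
entries are `m`-th roots of unity and for which the product of the nonzero entries is an
`(m / p)`-th root of unity. -/
def monomialGroup (m p r : ℕ) : Subgroup (GL (Fin r) ℂ) where
  carrier := {g | ∃ (π : Equiv.Perm (Fin r)) (θ : Fin r → ℂ),
    (∀ j, θ j ^ m = 1) ∧ (∏ j, θ j) ^ (m / p) = 1 ∧
      ∀ i j, g.val i j = if i = π j then θ j else 0}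
  one_mem' := ⟨1, 1, by simp, by simp, fun i j => by
    by_cases h : i = j <;> simp [h]⟩
  mul_mem' := by
    rintro g h ⟨π, θ, h1, h2, h3⟩ ⟨π', θ', h1', h2', h3'⟩
    refine ⟨π * π', fun j => θ (π' j) * θ' j, fun j => ?_, ?_, fun i j => ?_⟩
    · rw [mul_pow, h1, h1', one_mul]
    · rw [Finset.prod_mul_distrib, Equiv.prod_comp π' θ, mul_pow, h2, h2', one_mul]
    · by_cases h : i = π (π' j) <;> simp [Matrix.mul_apply, h3, h3', h]
  inv_mem' := by
    rintro g ⟨π, θ, h1, h2, h3⟩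
    have key : ∀ k j, (g⁻¹).val k (π j) * θ j = if k = j then 1 else 0 := by
      intro k j
      have h := congrFun (congrFun (Units.inv_mul g) k) j
      rw [Matrix.mul_apply, Matrix.one_apply] at h
      rw [← h]
      simp [h3]
    have hne : ∀ j, θ j ≠ 0 := by
      intro j h0
      have h := key j j
      simp [h0] at h
    refine ⟨π⁻¹, fun i => (θ (π⁻¹ i))⁻¹, fun i => ?_, ?_, fun k i => ?_⟩
    · rw [inv_pow, h1, inv_one]
    · rw [Finset.prod_inv_distrib, Equiv.prod_comp π⁻¹ θ, inv_pow, h2, inv_one]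
    · have h := key k (π⁻¹ i)
      rw [← Equiv.Perm.mul_apply, mul_inv_cancel, Equiv.Perm.one_apply] at h
      rw [eq_div_of_mul_eq (hne _) h]
      split_ifs <;> simp

/-- The group `N = G(ab, db, r)` as a subgroup of `G = G(ab, b, r)` (the intersection of the two
groups, regarded as a subgroup of the second one). -/
abbrev innerGroup (a b d r : ℕ) : Subgroup (monomialGroup (a * b) b r) :=
  (monomialGroup (a * b) (d * b) r).subgroupOf (monomialGroup (a * b) b r)

/-- Raise every nonzero entry of a matrix to the `n`-th power. -/
def entryPow {r : ℕ} (n : ℤ) (A : Matrix (Fin r) (Fin r) ℂ) : Matrix (Fin r) (Fin r) ℂ :=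
  fun i j => if A i j = 0 then 0 else A i j ^ n

theorem entryPow_one {r : ℕ} (n : ℤ) :
    entryPow n (1 : Matrix (Fin r) (Fin r) ℂ) = 1 := by
  ext i j
  by_cases h : i = j <;> simp [entryPow, Matrix.one_apply, h]

theorem entryPow_monomial {r : ℕ} (n : ℤ) {A : Matrix (Fin r) (Fin r) ℂ}
    {π : Equiv.Perm (Fin r)} {θ : Fin r → ℂ} (hθ : ∀ j, θ j ≠ 0)
    (h : ∀ i j, A i j = if i = π j then θ j else 0) (i j : Fin r) :
    entryPow n A i j = if i = π j then θ j ^ n else 0 := by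
  by_cases hij : i = π j <;> simp [entryPow, h, hij, hθ]

theorem monomial_ne_zero {r : ℕ} {g : GL (Fin r) ℂ} {π : Equiv.Perm (Fin r)}
    {θ : Fin r → ℂ} (h : ∀ i j, g.val i j = if i = π j then θ j else 0) (j : Fin r) :
    θ j ≠ 0 := by
  intro h0
  have h' := congrFun (congrFun (Units.inv_mul g) j) j
  rw [Matrix.mul_apply, Matrix.one_apply] at h'
  simp [h, h0] at h'

theorem entryPow_mul {m p r : ℕ} (n : ℤ) {g h : GL (Fin r) ℂ}
    (hg : g ∈ monomialGroup m p r) (hh : h ∈ monomialGroup m p r) :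
    entryPow n (g * h : GL (Fin r) ℂ).val = entryPow n g.val * entryPow n h.val := by
  obtain ⟨π, θ, -, -, h3⟩ := hg
  obtain ⟨π', θ', -, -, h3'⟩ := hh
  have hθ := monomial_ne_zero h3
  have hθ' := monomial_ne_zero h3'
  have h4 : ∀ i j, (g * h : GL (Fin r) ℂ).val i j
      = if i = (π * π') j then θ (π' j) * θ' j else 0 := by
    intro i j
    by_cases h : i = π (π' j) <;> simp [Matrix.mul_apply, h3, h3', h]
  ext i j
  rw [entryPow_monomial n (fun j => mul_ne_zero (hθ _) (hθ' _)) h4, Matrix.mul_apply]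
  simp [entryPow_monomial n hθ h3, entryPow_monomial n hθ' h3', mul_zpow]

/-- The endomorphism `μ_n` of `G(m, p, r)` which raises each nonzero matrix entry to the
`n`-th power. -/
def fakePow (m p r : ℕ) (n : ℤ) : monomialGroup m p r →* monomialGroup m p r where
  toFun g := ⟨⟨entryPow n g.1.val, entryPow n (g⁻¹).1.val,
      by rw [← entryPow_mul n g.2 (g⁻¹).2]; simp [entryPow_one],
      by rw [← entryPow_mul n (g⁻¹).2 g.2]; simp [entryPow_one]⟩, by
    obtain ⟨π, θ, h1, h2, h3⟩ := g.2
    refine ⟨π, fun j => θ j ^ n, fun j => ?_, ?_, fun i j =>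
      entryPow_monomial n (monomial_ne_zero h3) h3 i j⟩
    · rw [← zpow_natCast, zpow_comm, zpow_natCast, h1, one_zpow]
    · rw [Finset.prod_zpow, ← zpow_natCast, zpow_comm, zpow_natCast, h2, one_zpow]⟩
  map_one' := Subtype.ext (Units.ext (entryPow_one n))
  map_mul' g h := Subtype.ext (Units.ext (entryPow_mul n g.2 h.2))

/-- The fake tensor power `W^{⊠ n}` of a representation `W` of `G(m, p, r)`. -/
def fakeTensorPower {m p r : ℕ} {W : Type*} [AddCommGroup W] [Module ℂ W]
    (ρ : Representation ℂ (monomialGroup m p r) W) (n : ℤ) :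
    Representation ℂ (monomialGroup m p r) W :=
  ρ.comp (fakePow m p r n)

/-- The entries of the elements of `G(m, p, r)` lie in the `m`-th cyclotomic field. -/
theorem monomialGroup_entry_mem {m p r : ℕ} {ζ : ℂ} (hm : 0 < m) (hζ : IsPrimitiveRoot ζ m) :
    ∀ g ∈ monomialGroup m p r, ∀ i j, g.val i j ∈ IntermediateField.adjoin ℚ {ζ} := by
  rintro g ⟨π, θ, h1, -, h3⟩ i j
  rw [h3]
  split_ifs
  · have : NeZero m := ⟨hm.ne'⟩
    obtain ⟨k, -, hk⟩ := hζ.eq_pow_of_pow_eq_one (h1 j)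
    rw [← hk]
    exact pow_mem (IntermediateField.mem_adjoin_simple_self ℚ ζ) k
  · exact zero_mem _

/-- The Galois twist `V^σ` of `V = ℂ^r`, for a group `G ⊆ GL_r(K)` with `K ⊆ ℂ` and a field
automorphism `σ` of `K`: `g` acts on `ℂ^r` through the matrix `(σ (g i j))`. -/
def galoisTwist {r : ℕ} (G : Subgroup (GL (Fin r) ℂ)) (K : IntermediateField ℚ ℂ)
    (hG : ∀ g ∈ G, ∀ i j, g.val i j ∈ K) (σ : K ≃ₐ[ℚ] K) :
    Representation ℂ G (Fin r → ℂ) where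
  toFun g := Matrix.toLin' (Matrix.of fun i j => (σ ⟨g.1.val i j, hG g.1 g.2 i j⟩ : ℂ))
  map_one' := by
    refine Eq.trans (congrArg Matrix.toLin' ?_) Matrix.toLin'_one
    ext i j
    by_cases h : i = j
    · subst h
      have : (⟨((1 : G).1.val) i i, hG _ (1 : G).2 i i⟩ : K) = 1 := Subtype.ext (by simp)
      rw [Matrix.of_apply, this]
      simp
    · have : (⟨((1 : G).1.val) i j, hG _ (1 : G).2 i j⟩ : K) = 0 :=
        Subtype.ext (by simp [h])
      rw [Matrix.of_apply, this]
      simp [h]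
  map_mul' g h := by
    refine Eq.trans (congrArg Matrix.toLin' ?_) (Matrix.toLin'_mul _ _)
    ext i j
    have : (⟨((g * h : G).1.val) i j, hG _ (g * h).2 i j⟩ : K) =
        ∑ k, (⟨g.1.val i k, hG _ g.2 i k⟩ : K) * ⟨h.1.val k j, hG _ h.2 k j⟩ :=
      Subtype.ext (by simp [Matrix.mul_apply])
    rw [Matrix.of_apply, this, map_sum, Matrix.mul_apply]
    simp only [map_mul, Matrix.of_apply, IntermediateField.coe_sum, MulMemClass.coe_mul]

/-- The substitution `f ↦ f ∘ A` on polynomial functions on `ℂ^r`, `x_i ↦ ∑_j A i j x_j`. -/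
def linSubst {r : ℕ} (A : Matrix (Fin r) (Fin r) ℂ) :
    MvPolynomial (Fin r) ℂ →ₐ[ℂ] MvPolynomial (Fin r) ℂ :=
  aeval fun i => ∑ j, C (A i j) * X j

/-- The action of `GL_r(ℂ)` on the ring `S(V^*) = ℂ[x_1, …, x_r]` of polynomial functions on
`V = ℂ^r`, given by `(g f)(v) = f (g⁻¹ v)`. -/
def polyRep (r : ℕ) : Representation ℂ (GL (Fin r) ℂ) (MvPolynomial (Fin r) ℂ) where
  toFun g := (linSubst (g⁻¹).val).toLinearMap
  map_one' := by
    have : linSubst (1 : Matrix (Fin r) (Fin r) ℂ) = AlgHom.id ℂ _ := by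
      refine MvPolynomial.algHom_ext fun i => ?_
      simp [linSubst, Matrix.one_apply]
    rw [inv_one, Units.val_one, this]
    rfl
  map_mul' g h := by
    have : ∀ A B : Matrix (Fin r) (Fin r) ℂ,
        linSubst (A * B) = (linSubst B).comp (linSubst A) := by
      intro A B
      refine MvPolynomial.algHom_ext fun i => ?_
      simp only [linSubst, aeval_X, AlgHom.comp_apply, map_sum, map_mul, Matrix.mul_apply,
        Finset.sum_mul, Finset.mul_sum, algHom_C, algebraMap_eq, mul_assoc]
      rw [Finset.sum_comm]
    rw [mul_inv_rev, Units.val_mul, this]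
    rfl

/-- The algebra of polynomial (that is, constant coefficient) differential operators on
`ℂ[x_1, …, x_r]`, generated by the partial derivatives. -/
def polyDiffOp (r : ℕ) : Subalgebra ℂ (Module.End ℂ (MvPolynomial (Fin r) ℂ)) :=
  Algebra.adjoin ℂ (Set.range fun i : Fin r =>
    ((pderiv i : Derivation ℂ _ _) : MvPolynomial (Fin r) ℂ →ₗ[ℂ] MvPolynomial (Fin r) ℂ))

/-- The space of `N`-harmonic polynomials: those annihilated by all `N`-invariant polynomial
differential operators `T` without constant term. The group acts on differential operators by
conjugation, so that `T` is `N`-invariant if it commutes with the action of `N` on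
polynomials; the constant term of `T` is `T 1`. -/
def harmonicPoly {r : ℕ} {G : Subgroup (GL (Fin r) ℂ)} (N : Subgroup G) :
    Submodule ℂ (MvPolynomial (Fin r) ℂ) where
  carrier := {f | ∀ T ∈ polyDiffOp r,
    (∀ n ∈ N, polyRep r n * T = T * polyRep r n) → T 1 = 0 → T f = 0}
  add_mem' hf hg T h1 h2 h3 := by rw [map_add, hf T h1 h2 h3, hg T h1 h2 h3, add_zero]
  zero_mem' T _ _ _ := map_zero T
  smul_mem' c f hf T h1 h2 h3 := by rw [map_smul, hf T h1 h2 h3, smul_zero]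

theorem polyRep_mul_apply {r : ℕ} (g : GL (Fin r) ℂ) (p q : MvPolynomial (Fin r) ℂ) :
    polyRep r g (p * q) = polyRep r g p * polyRep r g q :=
  map_mul (linSubst (g⁻¹).val) p q

theorem polyRep_one_apply {r : ℕ} (g : GL (Fin r) ℂ) : polyRep r g 1 = 1 :=
  map_one (linSubst (g⁻¹).val)

theorem polyRep_C {r : ℕ} (g : GL (Fin r) ℂ) (c : ℂ) : polyRep r g (C c) = C c :=
  algHom_C (linSubst (g⁻¹).val) c

theorem polyRep_X {r : ℕ} (g : GL (Fin r) ℂ) (i : Fin r) :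
    polyRep r g (X i) = ∑ j, C ((g⁻¹).val i j) * X j :=
  aeval_X _ i

/-- Conjugation by a group element preserves the polynomial differential operators. -/
theorem polyDiffOp_conj {r : ℕ} (g : GL (Fin r) ℂ)
    {T : Module.End ℂ (MvPolynomial (Fin r) ℂ)} (hT : T ∈ polyDiffOp r) :
    polyRep r g⁻¹ * T * polyRep r g ∈ polyDiffOp r := by
  have hinv : polyRep r g * polyRep r g⁻¹ = 1 := by rw [← map_mul, mul_inv_cancel, map_one]
  have hinv' : polyRep r g⁻¹ * polyRep r g = 1 := by rw [← map_mul, inv_mul_cancel, map_one]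
  induction hT using Algebra.adjoin_induction with
  | mem T hT =>
    obtain ⟨i, rfl⟩ := hT
    have key : polyRep r g⁻¹ * ((pderiv i : Derivation ℂ _ _) :
          MvPolynomial (Fin r) ℂ →ₗ[ℂ] MvPolynomial (Fin r) ℂ) * polyRep r g
        = ∑ k, (g⁻¹).val k i • ((pderiv k : Derivation ℂ _ _) :
          MvPolynomial (Fin r) ℂ →ₗ[ℂ] MvPolynomial (Fin r) ℂ) := by
      have happ : ∀ p, polyRep r g⁻¹ (polyRep r g p) = p := fun p => LinearMap.congr_fun hinv' p
      have dsum : ∀ (c : Fin r → ℂ) (p : MvPolynomial (Fin r) ℂ),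
          (∑ k, c k • (pderiv k : Derivation ℂ (MvPolynomial (Fin r) ℂ) _)) p
            = ∑ k, c k • pderiv k p := by
        intro c p
        exact map_sum (⟨⟨fun D : Derivation ℂ (MvPolynomial (Fin r) ℂ) (MvPolynomial (Fin r) ℂ) =>
          D p, rfl⟩, fun _ _ => rfl⟩ : Derivation ℂ (MvPolynomial (Fin r) ℂ)
            (MvPolynomial (Fin r) ℂ) →+ MvPolynomial (Fin r) ℂ) _ _
      let D : Derivation ℂ (MvPolynomial (Fin r) ℂ) (MvPolynomial (Fin r) ℂ) :=
        Derivation.mk' (polyRep r g⁻¹ * ((pderiv i : Derivation ℂ _ _) :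
          MvPolynomial (Fin r) ℂ →ₗ[ℂ] MvPolynomial (Fin r) ℂ) * polyRep r g) fun p q => by
            simp only [Module.End.mul_apply, polyRep_mul_apply, Derivation.coeFn_coe,
              Derivation.leibniz, smul_eq_mul, map_add, happ]
      have hD : D = ∑ k, (g⁻¹).val k i • (pderiv k : Derivation ℂ _ _) := by
        refine derivation_ext fun k => ?_
        change polyRep r g⁻¹ (pderiv i (polyRep r g (X k))) = _
        rw [polyRep_X, map_sum, dsum]
        simp [pderiv_X, Pi.single_apply, polyRep_C, smul_eq_C_mul, Finset.sum_ite_eq]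
      refine LinearMap.ext fun p => ?_
      have hp : D p = _ := (congrArg (fun D : Derivation ℂ _ _ => D p) hD).trans (dsum _ p)
      simpa [D] using hp
    rw [key]
    exact Subalgebra.sum_mem _ fun k _ => Subalgebra.smul_mem _
      (Algebra.subset_adjoin (Set.mem_range_self k)) _
  | algebraMap c =>
    rw [← Algebra.commutes, mul_assoc, hinv', mul_one]
    exact Subalgebra.algebraMap_mem _ c
  | add S T _ _ hS hT =>
    rw [mul_add, add_mul]
    exact add_mem hS hT
  | mul S T _ _ hS hT =>
    have : polyRep r g⁻¹ * (S * T) * polyRep r g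
        = (polyRep r g⁻¹ * S * polyRep r g) * (polyRep r g⁻¹ * T * polyRep r g) := by
      calc polyRep r g⁻¹ * (S * T) * polyRep r g
          = polyRep r g⁻¹ * S * 1 * T * polyRep r g := by simp only [mul_assoc, mul_one]
        _ = _ := by rw [← hinv]; simp only [mul_assoc]
    rw [this]
    exact mul_mem hS hT

/-- The harmonic polynomials of a normal subgroup `N` of `G` form a `G`-stable space. -/
theorem harmonicPoly_stable {r : ℕ} {G : Subgroup (GL (Fin r) ℂ)} (N : Subgroup G) [hN : N.Normal]
    (g : G) : harmonicPoly N ≤ (harmonicPoly N).comap (((polyRep r).comp G.subtype) g) := by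
  intro f hf T hT hTN hT1
  have h := hf (polyRep r g.1⁻¹ * T * polyRep r g.1) (polyDiffOp_conj g.1 hT) ?_ ?_
  · have hinv : polyRep r g.1 * polyRep r g.1⁻¹ = 1 := by
      rw [← map_mul, mul_inv_cancel, map_one]
    have h' := congrArg (polyRep r g.1) h
    rw [map_zero, ← Module.End.mul_apply, ← mul_assoc, ← mul_assoc, hinv, one_mul] at h'
    exact h'
  · intro n hn
    have h1 := hTN _ (hN.conj_mem n hn g)
    have e1 : polyRep r (n : GL (Fin r) ℂ) * polyRep r g.1⁻¹
        = polyRep r g.1⁻¹ * polyRep r ((g * n * g⁻¹ : G) : GL (Fin r) ℂ) := by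
      rw [← map_mul, ← map_mul]
      congr 1
      simp [mul_assoc]
    have e2 : polyRep r ((g * n * g⁻¹ : G) : GL (Fin r) ℂ) * polyRep r g.1
        = polyRep r g.1 * polyRep r (n : GL (Fin r) ℂ) := by
      rw [← map_mul, ← map_mul]
      congr 1
      simp [mul_assoc]
    calc polyRep r (n : GL (Fin r) ℂ) * (polyRep r g.1⁻¹ * T * polyRep r g.1)
        = (polyRep r (n : GL (Fin r) ℂ) * polyRep r g.1⁻¹) * T * polyRep r g.1 := by
          simp only [mul_assoc]
      _ = polyRep r g.1⁻¹ * (polyRep r ((g * n * g⁻¹ : G) : GL (Fin r) ℂ) * T)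
          * polyRep r g.1 := by rw [e1]; simp only [mul_assoc]
      _ = polyRep r g.1⁻¹ * T * (polyRep r ((g * n * g⁻¹ : G) : GL (Fin r) ℂ)
          * polyRep r g.1) := by rw [h1]; simp only [mul_assoc]
      _ = _ := by rw [e2]; simp only [mul_assoc]
  · rw [Module.End.mul_apply, polyRep_one_apply, Module.End.mul_apply, hT1, map_zero]

/-- The `G`-module `𝒞_N` of `N`-harmonic polynomials, for `N` normal in `G`. -/
def harmonicRep {r : ℕ} {G : Subgroup (GL (Fin r) ℂ)} (N : Subgroup G) [N.Normal] :
    Representation ℂ G (harmonicPoly N) :=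
  Representation.subrepresentation ((polyRep r).comp G.subtype) (harmonicPoly N) (harmonicPoly_stable N)

/-- The space `(𝒞_N ⊗ M^*)^N` of `N`-invariants. -/
def orlikSolomonInvariants {r : ℕ} {G : Subgroup (GL (Fin r) ℂ)} (N : Subgroup G) [N.Normal]
    {M : Type*} [AddCommGroup M] [Module ℂ M] (ρ : Representation ℂ G M) :
    Submodule ℂ (TensorProduct ℂ (harmonicPoly N) (Module.Dual ℂ M)) where
  carrier := {x | ∀ n ∈ N, (harmonicRep N).tprod ρ.dual n x = x}
  add_mem' hx hy n hn := by rw [map_add, hx n hn, hy n hn]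
  zero_mem' n _ := map_zero _
  smul_mem' c x hx n hn := by rw [map_smul, hx n hn]

/-- The `G`-module `(U_M^N)^* = (𝒞_N ⊗ M^*)^N`, dual to the Orlik-Solomon space of the
`G`-module `M`. -/
def orlikSolomonDual {r : ℕ} {G : Subgroup (GL (Fin r) ℂ)} (N : Subgroup G) [hN : N.Normal]
    {M : Type*} [AddCommGroup M] [Module ℂ M] (ρ : Representation ℂ G M) :
    Representation ℂ G (orlikSolomonInvariants N ρ) :=
  Representation.subrepresentation ((harmonicRep N).tprod ρ.dual) (orlikSolomonInvariants N ρ)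
    fun g x hx n hn => by
      have h := hx _ (hN.conj_mem' n hn g)
      have h' := congrArg ((harmonicRep N).tprod ρ.dual g) h
      rw [← Module.End.mul_apply, ← map_mul, mul_assoc, mul_inv_cancel_left, map_mul,
        Module.End.mul_apply] at h'
      exact h'

/-- The Orlik-Solomon space `U_M^N`, the `G`-module dual to `(𝒞_N ⊗ M^*)^N`. -/
abbrev orlikSolomon {r : ℕ} {G : Subgroup (GL (Fin r) ℂ)} (N : Subgroup G) [N.Normal]
    {M : Type*} [AddCommGroup M] [Module ℂ M] (ρ : Representation ℂ G M) :
    Representation ℂ G (Module.Dual ℂ (orlikSolomonInvariants N ρ)) :=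
  (orlikSolomonDual N ρ).dual

/-- `f_1, …, f_r` are homogeneous, algebraically independent generators of the invariant ring
`S(V^*)^N`, and their linear span is stable under `G`. -/
structure IsStableInvariantSystem {r : ℕ} {G : Subgroup (GL (Fin r) ℂ)} (N : Subgroup G)
    (f : Fin r → MvPolynomial (Fin r) ℂ) : Prop where
  homogeneous : ∀ i, ∃ k, (f i).IsHomogeneous k
  algebraicIndependent : AlgebraicIndependent ℂ f
  mem_adjoin_iff : ∀ p, p ∈ Algebra.adjoin ℂ (Set.range f) ↔ ∀ n ∈ N, polyRep r n p = p
  stable : ∀ (g : G) (i : Fin r), polyRep r g (f i) ∈ Submodule.span ℂ (Set.range f)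

/-- The `G`-module `E^* = span {f_1, …, f_r}`, dual to `E = V / N`. -/
def quotientSpaceDual {r : ℕ} {G : Subgroup (GL (Fin r) ℂ)} {N : Subgroup G}
    {f : Fin r → MvPolynomial (Fin r) ℂ} (hf : IsStableInvariantSystem N f) :
    Representation ℂ G (Submodule.span ℂ (Set.range f)) :=
  Representation.subrepresentation ((polyRep r).comp G.subtype) _ fun g =>
    Submodule.span_le.2 (by rintro _ ⟨i, rfl⟩; exact hf.stable g i)

/-- The `G`-module `E = V / N`, where `V / N` is identified with `ℂ^r` by means of the
fundamental `N`-invariants `f_1, …, f_r`. -/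
abbrev quotientSpace {r : ℕ} {G : Subgroup (GL (Fin r) ℂ)} {N : Subgroup G}
    {f : Fin r → MvPolynomial (Fin r) ℂ} (hf : IsStableInvariantSystem N f) :
    Representation ℂ G (Module.Dual ℂ (Submodule.span ℂ (Set.range f))) :=
  (quotientSpaceDual hf).dual

end

open MvPolynomial

noncomputable section

/-! Put m = ab and q = db, so that N = G(m, q, r) and m = qe. For g in G let δ(g) be the product of
its nonzero entries. This is a character of G; its power δ^e maps G onto the d-th roots of unity
with kernel N, which settles normality and the quotient. The rest consists in showing that the
G-modules E^* and (U^N_σ)^* are both diagonal: each has r - 1 trivial characters, and the last one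
is δ^(-e) for E^* and δ^(-eC) for (U^N_σ)^*, where C = ⌈s/e⌉. Since δ(μ_C(g)) = δ(g)^C, twisting E^*
by μ_C identifies the two, and dualising gives the theorem.

For E^*, the standard generators of the invariants are e_1(x^m), …, e_{r-1}(x^m) and (x_1 ⋯ x_r)^e,
on which G acts by these characters. Any other stable system spans an isomorphic module: take linear
parts after writing its elements as polynomials in the standard generators
(`linearPartMap_injective`).

For (U^N_σ)^*, an N-invariant of S(V^*) ⊗ (V^σ)^* is a family (P_i) with g P_i = θ_i^s P_{π(i)}. The
family x_i^s P_i is then permuted without scalars. Torus invariance forces all exponents of a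
monomial to be congruent to a common multiple ec of e modulo m. If c < C, divisibility by x_i^s >
x_i^{ec} forces a further factor x_i^m; if c ≥ C, the factor (x_1 ⋯ x_r)^{eC} splits off. Hence
these families form the free module over the invariants on x_i^m, …, x_i^{m(r-1)} and (x_1 ⋯
x_r)^{eC} (`mem_covModule`, `fundCovariant_linearIndependent`).

Finally S(V^*) is the direct sum of the harmonic polynomials and the Hilbert ideal
(`isCompl_invariantIdeal`). Projecting along this ideal turns the free basis over the invariants
into a complex basis of (C_N ⊗ (V^σ)^*)^N, compatibly with G
(`exists_equiv_orlikSolomonInvariants`). -/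

/-! ### Monomial matrices and the product of their nonzero entries -/

/-- `g` is the monomial matrix with entry `θ j` in row `π j` of column `j`. -/
def IsMonomial {r : ℕ} (g : GL (Fin r) ℂ) (π : Equiv.Perm (Fin r)) (θ : Fin r → ℂ) : Prop :=
  ∀ i j, g.val i j = if i = π j then θ j else 0

/-- The monomial matrix with entry `θ j` in row `π j` of column `j`. -/
def monomialGL {r : ℕ} (π : Equiv.Perm (Fin r)) (θ : Fin r → ℂ) (hθ : ∀ j, θ j ≠ 0) :
    GL (Fin r) ℂ where
  val := Matrix.of fun i j => if i = π j then θ j else 0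
  inv := Matrix.of fun i j => if j = π i then (θ i)⁻¹ else 0
  val_inv := by
    ext i j
    rw [Matrix.mul_apply, Finset.sum_eq_single (π⁻¹ i)]
    · by_cases h : i = j <;> simp [h, hθ, Matrix.one_apply, eq_comm]
    · intro k _ hk
      have : i ≠ π k := fun h => hk (by simp [h])
      simp [this]
    · simp
  inv_val := by
    ext i j
    rw [Matrix.mul_apply, Finset.sum_eq_single (π i)]
    · by_cases h : i = j <;> simp [h, hθ, Matrix.one_apply]
    · intro k _ hk
      simp [hk]
    · simp

theorem isMonomial_monomialGL {r : ℕ} (π : Equiv.Perm (Fin r)) (θ : Fin r → ℂ)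
    (hθ : ∀ j, θ j ≠ 0) : IsMonomial (monomialGL π θ hθ) π θ := fun _ _ => rfl

/-- The product of the nonzero entries of a monomial matrix. -/
def entryProd {r : ℕ} (g : GL (Fin r) ℂ) : ℂ := ∏ j, ∑ i, g.val i j

namespace IsMonomial

variable {r : ℕ} {g h : GL (Fin r) ℂ} {π π' : Equiv.Perm (Fin r)} {θ θ' : Fin r → ℂ}

theorem ne_zero (hg : IsMonomial g π θ) (j : Fin r) : θ j ≠ 0 := monomial_ne_zero hg j

theorem sum_col (hg : IsMonomial g π θ) (j : Fin r) : ∑ i, g.val i j = θ j := by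
  simp [hg _ _]

theorem entryProd_eq (hg : IsMonomial g π θ) : entryProd g = ∏ j, θ j := by
  simp [entryProd, hg.sum_col]

theorem mul (hg : IsMonomial g π θ) (hh : IsMonomial h π' θ') :
    IsMonomial (g * h) (π * π') (fun j => θ (π' j) * θ' j) := by
  intro i j
  by_cases h : i = π (π' j) <;> simp [Matrix.mul_apply, hg _ _, hh _ _, h]

theorem inv_apply (hg : IsMonomial g π θ) (i j : Fin r) :
    (g⁻¹).val i j = if j = π i then (θ i)⁻¹ else 0 := by
  have : g = monomialGL π θ hg.ne_zero := Units.ext (by ext i j; exact hg i j)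
  rw [this]
  rfl

/-- The nonzero entries are the column sums, hence determined by the matrix. Membership can
therefore be tested on any presentation, despite the existential in the definition of the group. -/
theorem mem_monomialGroup_iff (hg : IsMonomial g π θ) {m p : ℕ} :
    g ∈ monomialGroup m p r ↔ (∀ j, θ j ^ m = 1) ∧ (∏ j, θ j) ^ (m / p) = 1 := by
  refine ⟨?_, fun h => ⟨π, θ, h.1, h.2, hg⟩⟩
  rintro ⟨π', θ', h1, h2, h3 : IsMonomial g π' θ'⟩
  have : θ' = θ := by ext j; rw [← hg.sum_col, h3.sum_col]
  rw [← this]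
  exact ⟨h1, h2⟩

end IsMonomial

theorem exists_isMonomial {m p r : ℕ} {g : GL (Fin r) ℂ} (hg : g ∈ monomialGroup m p r) :
    ∃ π θ, IsMonomial g π θ := by
  obtain ⟨π, θ, -, -, h⟩ := hg
  exact ⟨π, θ, h⟩

theorem finite_monomialGroup {m : ℕ} (hm : 0 < m) (p r : ℕ) :
    (monomialGroup m p r : Set (GL (Fin r) ℂ)).Finite := by
  have hfin : {z : ℂ | z ^ m = 1}.Finite := by
    have : {z : ℂ | z ^ m = 1} ⊆ ((Polynomial.nthRoots m (1 : ℂ)).toFinset : Set ℂ) := by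
      intro z hz
      simpa [Polynomial.mem_nthRoots hm] using hz
    exact (Finset.finite_toSet _).subset this
  have h2 : {x : Equiv.Perm (Fin r) × (Fin r → ℂ) | ∀ j, x.2 j ^ m = 1}.Finite := by
    have := (Set.finite_univ (α := Equiv.Perm (Fin r))).prod
      (Set.Finite.pi' (ι := Fin r) (t := fun _ => {z : ℂ | z ^ m = 1}) fun _ => hfin)
    exact this.subset fun x hx => ⟨trivial, hx⟩
  have h3 := h2.image fun x => (Matrix.of fun i j => if i = x.1 j then x.2 j else 0 :
    Matrix (Fin r) (Fin r) ℂ)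
  refine Set.Finite.of_finite_image (f := fun g : GL (Fin r) ℂ => g.val) (h3.subset ?_)
    Units.val_injective.injOn
  rintro _ ⟨g, ⟨π, θ, h1, -, h⟩, rfl⟩
  exact ⟨(π, θ), h1, by ext i j; exact (h i j).symm⟩

theorem entryProd_mul {m p r : ℕ} {g h : GL (Fin r) ℂ} (hg : g ∈ monomialGroup m p r)
    (hh : h ∈ monomialGroup m p r) : entryProd (g * h) = entryProd g * entryProd h := by
  obtain ⟨π, θ, hg⟩ := exists_isMonomial hg
  obtain ⟨π', θ', hh⟩ := exists_isMonomial hh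
  rw [(hg.mul hh).entryProd_eq, hg.entryProd_eq, hh.entryProd_eq, Finset.prod_mul_distrib,
    Equiv.prod_comp π' θ]

/-- The product of the nonzero entries, as a homomorphism on `G(m, p, r)`. -/
def entryProdHom (m p r : ℕ) : monomialGroup m p r →* ℂ where
  toFun g := entryProd g.1
  map_one' := by simp [entryProd, Matrix.one_apply]
  map_mul' g h := entryProd_mul g.2 h.2

theorem entryProdHom_fakePow {m p r : ℕ} (n : ℤ) (g : monomialGroup m p r) :
    entryProdHom m p r (fakePow m p r n g) = entryProdHom m p r g ^ n := by
  obtain ⟨π, θ, hg⟩ := exists_isMonomial g.2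
  have h : IsMonomial (fakePow m p r n g).1 π (fun j => θ j ^ n) :=
    fun i j => entryPow_monomial n hg.ne_zero hg i j
  change entryProd _ = entryProd _ ^ n
  rw [h.entryProd_eq, hg.entryProd_eq, Finset.prod_zpow]

/-! ### The cyclic quotient G/N -/

section Quotient

variable {d e b r : ℕ}

theorem mul_div_inner (hd : 0 < d) (hb : 0 < b) : d * e * b / (d * b) = e := by
  rw [show d * e * b = e * (d * b) by ring]
  exact Nat.mul_div_cancel _ (Nat.mul_pos hd hb)

theorem mem_inner_iff (hd : 0 < d) (hb : 0 < b) {g : GL (Fin r) ℂ}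
    (hg : g ∈ monomialGroup (d * e * b) b r) :
    g ∈ monomialGroup (d * e * b) (d * b) r ↔ entryProd g ^ e = 1 := by
  obtain ⟨π, θ, h⟩ := exists_isMonomial hg
  rw [h.mem_monomialGroup_iff, mul_div_inner hd hb, h.entryProd_eq]
  exact and_iff_right (h.mem_monomialGroup_iff.1 hg).1

theorem monomialGroup_le (hd : 0 < d) (hb : 0 < b) :
    monomialGroup (d * e * b) (d * b) r ≤ monomialGroup (d * e * b) b r := by
  rintro g ⟨π, θ, h1, h2, h3⟩
  refine ⟨π, θ, h1, ?_, h3⟩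
  rw [mul_div_inner hd hb] at h2
  rw [Nat.mul_div_cancel _ hb, mul_comm, pow_mul, h2, one_pow]

/-- The homomorphism from `G(deb, b, r)` to the units of `ℂ` whose kernel is `G(deb, db, r)`. -/
def quotientHom (d e b r : ℕ) : monomialGroup (d * e * b) b r →* ℂˣ :=
  ((powMonoidHom e).comp (entryProdHom (d * e * b) b r)).toHomUnits

theorem quotientHom_val (g : monomialGroup (d * e * b) b r) :
    (quotientHom d e b r g : ℂ) = entryProd g.1 ^ e := rfl

theorem ker_quotientHom (hd : 0 < d) (hb : 0 < b) :
    (quotientHom d e b r).ker = innerGroup (d * e) b d r := by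
  ext g
  rw [MonoidHom.mem_ker, Subgroup.mem_subgroupOf, mem_inner_iff hd hb g.2, Units.ext_iff,
    quotientHom_val, Units.val_one]

theorem innerGroup_normal (hd : 0 < d) (hb : 0 < b) : (innerGroup (d * e) b d r).Normal := by
  rw [← ker_quotientHom hd hb]
  infer_instance

/-- On G the (de)-th power of the entry product is 1, so its e-th power is a d-th root of unity.
Conversely, an e-th root of the given root of unity, put in a single diagonal slot, is a preimage.
-/
theorem range_quotientHom (hr : 1 ≤ r) (he : 0 < e) (hb : 0 < b) :
    (quotientHom d e b r).range = rootsOfUnity d ℂ := by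
  ext z
  rw [mem_rootsOfUnity, MonoidHom.mem_range]
  constructor
  · rintro ⟨g, rfl⟩
    obtain ⟨π, θ, h⟩ := exists_isMonomial g.2
    have h2 := (h.mem_monomialGroup_iff.1 g.2).2
    rw [Nat.mul_div_cancel _ hb, ← h.entryProd_eq] at h2
    rw [Units.ext_iff, Units.val_pow_eq_pow_val, quotientHom_val, ← pow_mul, mul_comm e, h2,
      Units.val_one]
  · intro hz
    obtain ⟨w, hw⟩ := IsAlgClosed.exists_pow_nat_eq (z : ℂ) he
    have hw0 : w ≠ 0 := by
      rintro rfl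
      rw [zero_pow he.ne'] at hw
      exact z.ne_zero hw.symm
    have hwd : w ^ (d * e) = 1 := by
      rw [mul_comm, pow_mul, hw, ← Units.val_pow_eq_pow_val, hz, Units.val_one]
    let i₀ : Fin r := ⟨0, hr⟩
    let θ : Fin r → ℂ := Function.update 1 i₀ w
    have hprod : ∏ j, θ j = w := by
      rw [Finset.prod_update_of_mem (Finset.mem_univ _)]
      simp
    have hθ : ∀ j, θ j ≠ 0 := by
      intro j
      by_cases hj : j = i₀
      · subst hj; simpa [θ] using hw0
      · simp [θ, hj]
    have hm := isMonomial_monomialGL 1 θ hθ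
    refine ⟨⟨monomialGL 1 θ hθ, hm.mem_monomialGroup_iff.2 ⟨fun j => ?_, ?_⟩⟩, ?_⟩
    · by_cases hj : j = i₀
      · subst hj; simp [θ, pow_mul, hwd]
      · simp [θ, hj]
    · rw [hprod, Nat.mul_div_cancel _ hb, hwd]
    · rw [Units.ext_iff, quotientHom_val, hm.entryProd_eq, hprod, hw]

theorem nonempty_quotient_mulEquiv (hr : 1 ≤ r) (hd : 0 < d) (he : 0 < e) (hb : 0 < b)
    [(innerGroup (d * e) b d r).Normal] :
    Nonempty (monomialGroup (d * e * b) b r ⧸ innerGroup (d * e) b d r ≃*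
      Multiplicative (ZMod d)) := by
  have : NeZero d := ⟨hd.ne'⟩
  have e1 := QuotientGroup.quotientMulEquivOfEq (ker_quotientHom (r := r) (e := e) hd hb).symm
  have e2 := QuotientGroup.quotientKerEquivRange (quotientHom d e b r)
  have e3 := MulEquiv.subgroupCongr (range_quotientHom (d := d) hr he hb)
  have hcard : Nat.card (rootsOfUnity d ℂ) = d := Complex.card_rootsOfUnity d
  have e4 : rootsOfUnity d ℂ ≃* Multiplicative (ZMod d) :=
    mulEquivOfCyclicCardEq (by rw [hcard]; simp)
  exact ⟨e1.trans (e2.trans (e3.trans e4))⟩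

end Quotient

/-! ### Monomial matrices acting on polynomials, and torus weights -/

/-- The substitution `x_i ↦ t_i x_i`. -/
def scaleVars {r : ℕ} (t : Fin r → ℂ) : MvPolynomial (Fin r) ℂ →ₐ[ℂ] MvPolynomial (Fin r) ℂ :=
  aeval fun i => C (t i) * X i

theorem scaleVars_monomial {r : ℕ} (t : Fin r → ℂ) (k : Fin r →₀ ℕ) (c : ℂ) :
    scaleVars t (monomial k c) = monomial k ((∏ i, t i ^ k i) * c) := by
  rw [scaleVars, aeval_monomial, algebraMap_eq, Finsupp.prod_fintype _ _ (by simp)]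
  simp_rw [mul_pow, ← C_pow]
  rw [Finset.prod_mul_distrib, ← map_prod C, ← mul_assoc, ← C_mul, mul_comm c, monomial_eq (a := _ * c),
    Finsupp.prod_fintype _ _ (by simp)]

theorem coeff_scaleVars {r : ℕ} (t : Fin r → ℂ) (k : Fin r →₀ ℕ) (P : MvPolynomial (Fin r) ℂ) :
    coeff k (scaleVars t P) = (∏ i, t i ^ k i) * coeff k P := by
  classical
  induction P using MvPolynomial.induction_on' with
  | monomial l c =>
    rw [scaleVars_monomial, coeff_monomial, coeff_monomial]
    split_ifs with h
    · rw [h]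
    · simp
  | add p q hp hq => rw [map_add, coeff_add, coeff_add, hp, hq, mul_add]

theorem polyRep_apply {r : ℕ} (g : GL (Fin r) ℂ) (P : MvPolynomial (Fin r) ℂ) :
    polyRep r g P = linSubst (g⁻¹).val P := rfl

theorem linSubst_inv {r : ℕ} {g : GL (Fin r) ℂ} {π : Equiv.Perm (Fin r)} {θ : Fin r → ℂ}
    (hg : IsMonomial g π θ) :
    linSubst (g⁻¹).val = (rename π).comp (scaleVars fun i => (θ i)⁻¹) := by
  refine algHom_ext fun i => ?_
  simp [linSubst, scaleVars, hg.inv_apply, apply_ite C, ite_mul]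

theorem IsMonomial.polyRep_eq {r : ℕ} {g : GL (Fin r) ℂ} {π : Equiv.Perm (Fin r)} {θ : Fin r → ℂ}
    (hg : IsMonomial g π θ) (P : MvPolynomial (Fin r) ℂ) :
    polyRep r g P = rename π (scaleVars (fun i => (θ i)⁻¹) P) := by
  rw [polyRep_apply, linSubst_inv hg]
  rfl

theorem IsMonomial.polyRep_expand {r m : ℕ} {g : GL (Fin r) ℂ} {π : Equiv.Perm (Fin r)}
    {θ : Fin r → ℂ} (hg : IsMonomial g π θ) (hθ : ∀ j, θ j ^ m = 1)
    (P : MvPolynomial (Fin r) ℂ) : polyRep r g (expand m P) = expand m (rename π P) := by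
  have : (linSubst (g⁻¹).val).comp (expand m) =
      (expand m).comp (rename π : _ →ₐ[ℂ] MvPolynomial (Fin r) ℂ) := by
    rw [linSubst_inv hg]
    refine algHom_ext fun i => ?_
    simp [scaleVars, mul_pow, ← C_pow, hθ]
  exact DFunLike.congr_fun this P

theorem IsMonomial.polyRep_prod_X {r : ℕ} {g : GL (Fin r) ℂ} {π : Equiv.Perm (Fin r)}
    {θ : Fin r → ℂ} (hg : IsMonomial g π θ) :
    polyRep r g (∏ i, X i) = C (entryProd g)⁻¹ * ∏ i, X i := by
  rw [polyRep_apply, linSubst_inv hg, map_prod, hg.entryProd_eq, ← Finset.prod_inv_distrib,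
    map_prod]
  simp only [scaleVars, AlgHom.comp_apply, aeval_X, map_mul, rename_X, rename_C,
    Finset.prod_mul_distrib]
  rw [Equiv.prod_comp π (fun i => (X i : MvPolynomial (Fin r) ℂ))]

theorem monomialGL_one_mem {m p r : ℕ} {π : Equiv.Perm (Fin r)} :
    monomialGL π 1 (fun _ => one_ne_zero) ∈ monomialGroup m p r :=
  (isMonomial_monomialGL _ _ _).mem_monomialGroup_iff.2 ⟨by simp, by simp⟩

theorem polyRep_perm {r : ℕ} (π : Equiv.Perm (Fin r)) (P : MvPolynomial (Fin r) ℂ) :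
    polyRep r (monomialGL π 1 (fun _ => one_ne_zero)) P = rename π P := by
  rw [(isMonomial_monomialGL _ _ _).polyRep_eq]
  congr 1
  have : scaleVars (fun i => ((1 : Fin r → ℂ) i)⁻¹) = AlgHom.id ℂ _ :=
    algHom_ext fun i => by simp [scaleVars]
  rw [this]
  rfl

/-- Two kinds of diagonal matrices suffice. Entries ζ and ζ⁻¹ in two slots force all exponents to
agree modulo m; the entry ζ^q in one slot forces e to divide the exponent there. The number c is the
residue modulo q of that exponent divided by e. -/
theorem modEq_of_torus {r m q e : ℕ} (hr : 1 ≤ r) (hm : m = q * e) (hq : 0 < q) (he : 0 < e)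
    {ζ : ℂ} (hζ : IsPrimitiveRoot ζ m) {K : Fin r → ℕ}
    (hK : ∀ θ : Fin r → ℂ, (∀ j, θ j ^ m = 1) → (∏ j, θ j) ^ e = 1 → ∏ j, θ j ^ K j = 1) :
    ∃ c < q, ∀ j, K j ≡ e * c [MOD m] := by
  have hm0 : 0 < m := hm ▸ Nat.mul_pos hq he
  have hζ0 : ζ ≠ 0 := hζ.ne_zero hm0.ne'
  let i₀ : Fin r := ⟨0, hr⟩
  have h1 : ∀ j, K j ≡ K i₀ [MOD m] := by
    intro j
    by_cases hj : j = i₀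
    · rw [hj]
    have h := hK (Function.update (Function.update (1 : Fin r → ℂ) j ζ) i₀ ζ⁻¹) ?_ ?_
    · have e1 : ∀ l, (Function.update (Function.update (1 : Fin r → ℂ) j ζ) i₀ ζ⁻¹ : Fin r → ℂ) l ^ K l =
          Function.update (Function.update (1 : Fin r → ℂ) j (ζ ^ K j)) i₀ (ζ⁻¹ ^ K i₀) l := by
        intro l
        by_cases hl : l = i₀
        · subst hl; simp
        · by_cases hl' : l = j
          · subst hl'; simp [hl]
          · simp [hl, hl']
      simp_rw [e1] at h
      rw [Finset.prod_update_of_mem (Finset.mem_univ _), Finset.prod_update_of_mem (by simpa using hj)] at h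
      simp only [Pi.one_apply, Finset.prod_const_one, mul_one, inv_pow] at h
      rw [inv_mul_eq_one₀ (pow_ne_zero _ hζ0)] at h
      rw [hζ.eq_orderOf]
      have hu : IsUnit ζ := hζ0.isUnit
      lift ζ to ℂˣ using hu
      rw [orderOf_units, ← pow_eq_pow_iff_modEq]
      exact Units.ext (by simpa using h.symm)
    · intro l
      by_cases hl : l = i₀
      · subst hl; simp [hζ.pow_eq_one]
      · by_cases hl' : l = j
        · subst hl'; simp [hl, hζ.pow_eq_one]
        · simp [hl, hl']
    · rw [Finset.prod_update_of_mem (Finset.mem_univ _), Finset.prod_update_of_mem (by simpa using hj)]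
      simp [hζ0]
  have h2 : e ∣ K i₀ := by
    have h := hK (Function.update (1 : Fin r → ℂ) i₀ (ζ ^ q)) ?_ ?_
    · have e1 : ∀ l, (Function.update (1 : Fin r → ℂ) i₀ (ζ ^ q) : Fin r → ℂ) l ^ K l =
          Function.update (1 : Fin r → ℂ) i₀ ((ζ ^ q) ^ K i₀) l := by
        intro l
        by_cases hl : l = i₀
        · subst hl; simp
        · simp [hl]
      simp_rw [e1] at h
      rw [Finset.prod_update_of_mem (Finset.mem_univ _)] at h
      simp only [Pi.one_apply, Finset.prod_const_one, mul_one, ← pow_mul] at h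
      rw [hζ.pow_eq_one_iff_dvd, hm] at h
      exact Nat.dvd_of_mul_dvd_mul_left hq h
    · intro l
      by_cases hl : l = i₀
      · subst hl; simp [← pow_mul, mul_comm q, pow_mul _ m, hζ.pow_eq_one]
      · simp [hl]
    · rw [Finset.prod_update_of_mem (Finset.mem_univ _)]
      simp [← pow_mul, ← hm, hζ.pow_eq_one]
  refine ⟨(K i₀ / e) % q, Nat.mod_lt _ hq, fun j => (h1 j).trans ?_⟩
  rw [← Nat.mul_mod_mul_left, Nat.mul_div_cancel' h2, mul_comm e, ← hm]
  exact (Nat.mod_modEq _ _).symm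

/-- A monomial with exponents `e c + m l_i` is `(∏ x_i)^{ec}` times a monomial in the `x_i^m`. -/
theorem monomial_eq_mul_expand {r m n : ℕ} {k : Fin r →₀ ℕ} (hn : n < m)
    (hk : ∀ j, k j ≡ n [MOD m]) :
    ∃ l : Fin r →₀ ℕ, (∀ j, k j = n + m * l j) ∧
      monomial k (1 : ℂ) = (∏ i, X i) ^ n * expand m (monomial l 1) := by
  have hkl : ∀ j, k j = n + m * (Finsupp.equivFunOnFinite.symm fun j => k j / m) j := fun j => by
    have h := hk j
    rw [Nat.ModEq, Nat.mod_eq_of_lt hn] at h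
    rw [Finsupp.equivFunOnFinite_symm_apply_apply]
    conv_lhs => rw [← Nat.mod_add_div (k j) m, h]
  refine ⟨Finsupp.equivFunOnFinite.symm fun j => k j / m, hkl, ?_⟩
  rw [expand_monomial, monomial_eq, monomial_eq (s := m • _), Finsupp.prod_fintype _ _ (by simp),
    Finsupp.prod_fintype _ _ (by simp), ← Finset.prod_pow]
  simp only [C_1, one_mul]
  rw [← Finset.prod_mul_distrib]
  refine Finset.prod_congr rfl fun j _ => ?_
  rw [Finsupp.smul_apply, smul_eq_mul, ← pow_add, ← hkl]

theorem IsMonomial.prod_pow_eq_one_of_coeff_ne_zero {r : ℕ} {P : MvPolynomial (Fin r) ℂ}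
    {θ : Fin r → ℂ} {g : GL (Fin r) ℂ} {c : ℂ} (hg : IsMonomial g 1 θ)
    (h : polyRep r g P = C c * P) {k : Fin r →₀ ℕ} (hk : coeff k P ≠ 0) :
    c * ∏ j, θ j ^ k j = 1 := by
  have h' := congrArg (coeff k) h
  have : rename (1 : Equiv.Perm (Fin r)) (scaleVars (fun i => (θ i)⁻¹) P) =
      scaleVars (fun i => (θ i)⁻¹) P := rename_id_apply _
  rw [hg.polyRep_eq, this, coeff_scaleVars, coeff_C_mul] at h'
  have h2 := mul_right_cancel₀ hk h'
  rw [← h2, ← Finset.prod_mul_distrib]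
  exact Finset.prod_eq_one fun j _ => by
    rw [← mul_pow, inv_mul_cancel₀ (hg.ne_zero j), one_pow]

/-! ### The invariant ring of G(m, q, r) -/

/-- The fundamental invariants `e_1(x^m), …, e_{r-1}(x^m), (x_1 ⋯ x_r)^e`. -/
def stdInvariant (r m e : ℕ) (i : Fin r) : MvPolynomial (Fin r) ℂ :=
  if (i : ℕ) + 1 < r then expand m (esymm (Fin r) ℂ (i + 1)) else (∏ j, X j) ^ e

theorem esymm_self {r : ℕ} : esymm (Fin r) ℂ r = ∏ j, X j := by
  have : Finset.powersetCard r (Finset.univ : Finset (Fin r)) = {Finset.univ} := by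
    simpa using Finset.powersetCard_self (Finset.univ : Finset (Fin r))
  rw [esymm, this, Finset.sum_singleton]

section Invariants

variable {r m q e : ℕ}

theorem expand_prod_X (hm : m = q * e) :
    expand m (∏ j, X j : MvPolynomial (Fin r) ℂ) = ((∏ j, X j) ^ e) ^ q := by
  simp only [map_prod, expand_X]
  rw [Finset.prod_pow, ← pow_mul, hm, mul_comm]

theorem prod_X_mem_adjoin (hr : 1 ≤ r) :
    (∏ j, X j) ^ e ∈ Algebra.adjoin ℂ (Set.range (stdInvariant r m e)) := by
  refine Algebra.subset_adjoin ⟨⟨r - 1, by omega⟩, ?_⟩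
  rw [stdInvariant, if_neg (by simp; omega)]

/-- By the fundamental theorem on symmetric polynomials it is enough to treat the e_i(x^m). The only
one that is not a generator is the top one, and it is the q-th power of (x_1 ⋯ x_r)^e. -/
theorem expand_mem_adjoin (hr : 1 ≤ r) (hm : m = q * e) {P : MvPolynomial (Fin r) ℂ}
    (hP : P.IsSymmetric) :
    expand m P ∈ Algebra.adjoin ℂ (Set.range (stdInvariant r m e)) := by
  obtain ⟨F, hF⟩ := esymmAlgHom_surjective (σ := Fin r) (n := r) ℂ (by simp) ⟨P, hP⟩
  have h1 := congrArg Subtype.val hF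
  rw [esymmAlgHom_apply] at h1
  simp only at h1
  rw [← h1, ← AlgHom.comp_apply, comp_aeval]
  have : aeval (fun i : Fin r => expand m (esymm (Fin r) ℂ (i + 1))) F ∈
      Algebra.adjoin ℂ (Set.range fun i : Fin r => expand m (esymm (Fin r) ℂ (i + 1))) := by
    rw [Algebra.adjoin_range_eq_range_aeval]
    exact ⟨F, rfl⟩
  refine Algebra.adjoin_le ?_ this
  rintro _ ⟨i, rfl⟩
  by_cases hi : (i : ℕ) + 1 < r
  · exact Algebra.subset_adjoin ⟨i, by rw [stdInvariant, if_pos hi]⟩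
  · have : (i : ℕ) + 1 = r := by omega
    simp only [this, esymm_self]
    rw [expand_prod_X hm]
    exact pow_mem (prod_X_mem_adjoin hr) _

theorem isSymmetric_sum_rename (P : MvPolynomial (Fin r) ℂ) :
    (∑ π : Equiv.Perm (Fin r), rename π P).IsSymmetric := by
  intro τ
  rw [map_sum]
  simp only [rename_rename]
  exact Fintype.sum_equiv (Equiv.mulLeft τ) _ _ fun π => rfl

theorem rename_prod_X (π : Equiv.Perm (Fin r)) :
    rename π (∏ j, X j : MvPolynomial (Fin r) ℂ) = ∏ j, X j := by
  simp only [map_prod, rename_X]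
  exact Equiv.prod_comp π (fun i => (X i : MvPolynomial (Fin r) ℂ))

/-- Up to the factor r!, an invariant is the sum of the symmetrisations of its terms. By torus
invariance each monomial is (x_1 ⋯ x_r)^{ec} times a monomial in the x_i^m, so its symmetrisation is
a power of the last generator times a symmetric polynomial in the x_i^m. -/
theorem mem_adjoin_of_invariant (hr : 1 ≤ r) (hm : m = q * e) (hq : 0 < q) (he : 0 < e)
    {ζ : ℂ} (hζ : IsPrimitiveRoot ζ m) {P : MvPolynomial (Fin r) ℂ}
    (hP : ∀ g ∈ monomialGroup m q r, polyRep r g P = P) :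
    P ∈ Algebra.adjoin ℂ (Set.range (stdInvariant r m e)) := by
  have hm0 : 0 < m := hm ▸ Nat.mul_pos hq he
  have hmq : m / q = e := by rw [hm, Nat.mul_div_cancel_left _ hq]
  have h1 : (Fintype.card (Equiv.Perm (Fin r)) : ℂ) • P =
      ∑ k ∈ P.support, ∑ π : Equiv.Perm (Fin r), coeff k P • rename π (monomial k (1 : ℂ)) := by
    rw [Finset.sum_comm]
    have : ∀ π : Equiv.Perm (Fin r),
        ∑ k ∈ P.support, coeff k P • rename π (monomial k (1 : ℂ)) = P := by
      intro π
      have h2 := hP _ (monomialGL_one_mem (π := π))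
      rw [polyRep_perm] at h2
      conv_rhs => rw [← h2, P.as_sum, map_sum]
      refine Finset.sum_congr rfl fun k _ => ?_
      rw [← map_smul, smul_monomial, smul_eq_mul, mul_one]
    simp only [this]
    rw [Finset.sum_const, Finset.card_univ, Nat.cast_smul_eq_nsmul]
  have hcard : (Fintype.card (Equiv.Perm (Fin r)) : ℂ) ≠ 0 :=
    Nat.cast_ne_zero.2 Fintype.card_ne_zero
  rw [← inv_smul_smul₀ hcard P, h1]
  refine Subalgebra.smul_mem _ (Subalgebra.sum_mem _ fun k hk => ?_) _
  rw [← Finset.smul_sum]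
  refine Subalgebra.smul_mem _ ?_ _
  obtain ⟨c, hc, hkc⟩ := modEq_of_torus hr hm hq he hζ (K := k) fun θ h1 h2 => by
    have hθ : ∀ j, θ j ≠ 0 := fun j h => by
      have := h1 j
      rw [h, zero_pow hm0.ne'] at this
      exact zero_ne_one this
    have hg := isMonomial_monomialGL 1 θ hθ
    have := hg.prod_pow_eq_one_of_coeff_ne_zero (c := 1)
      (by rw [C_1, one_mul]; exact hP _ (hg.mem_monomialGroup_iff.2 ⟨h1, by rw [hmq, h2]⟩))
      (mem_support_iff.1 hk)
    rwa [one_mul] at this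
  obtain ⟨l, -, hl⟩ := monomial_eq_mul_expand
    (by rw [hm, mul_comm q]; exact Nat.mul_lt_mul_of_pos_left hc he) hkc
  have h3 : ∑ π : Equiv.Perm (Fin r), rename π (monomial k (1 : ℂ)) =
      ((∏ j, X j) ^ e) ^ c * expand m (∑ π : Equiv.Perm (Fin r), rename π (monomial l 1)) := by
    rw [hl, map_sum, Finset.mul_sum]
    refine Finset.sum_congr rfl fun π _ => ?_
    rw [map_mul, map_pow, rename_prod_X, rename_expand, pow_mul]
  rw [h3]
  exact mul_mem (pow_mem (prod_X_mem_adjoin hr) _)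
    (expand_mem_adjoin hr hm (isSymmetric_sum_rename _))

/-- The character by which a monomial matrix acts on the `i`-th fundamental invariant. -/
def stdChar (e : ℕ) (z : ℂ) (i : Fin r) : ℂ := if (i : ℕ) + 1 < r then 1 else (z ^ e)⁻¹

theorem polyRep_stdInvariant {p : ℕ} {g : GL (Fin r) ℂ} (hg : g ∈ monomialGroup m p r)
    (i : Fin r) :
    polyRep r g (stdInvariant r m e i) = stdChar e (entryProd g) i • stdInvariant r m e i := by
  obtain ⟨π, θ, h⟩ := exists_isMonomial hg
  unfold stdInvariant stdChar
  split_ifs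
  · rw [h.polyRep_expand (h.mem_monomialGroup_iff.1 hg).1, esymm_isSymmetric, one_smul]
  · rw [polyRep_apply, map_pow, ← polyRep_apply, h.polyRep_prod_X, mul_pow, ← C_pow, inv_pow,
      smul_eq_C_mul]

theorem invariant_of_mem_adjoin (hm : m = q * e) (hq : 0 < q) {P : MvPolynomial (Fin r) ℂ}
    (hP : P ∈ Algebra.adjoin ℂ (Set.range (stdInvariant r m e))) {g : GL (Fin r) ℂ}
    (hg : g ∈ monomialGroup m q r) : polyRep r g P = P := by
  have hmq : m / q = e := by rw [hm, Nat.mul_div_cancel_left _ hq]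
  suffices Algebra.adjoin ℂ (Set.range (stdInvariant r m e)) ≤
      AlgHom.equalizer (linSubst (g⁻¹).val) (AlgHom.id ℂ _) from this hP
  refine Algebra.adjoin_le ?_
  rintro _ ⟨i, rfl⟩
  change polyRep r g _ = _
  rw [polyRep_stdInvariant hg]
  obtain ⟨π, θ, h⟩ := exists_isMonomial hg
  have h2 := (h.mem_monomialGroup_iff.1 hg).2
  rw [hmq, ← h.entryProd_eq] at h2
  have : stdChar e (entryProd g) i = 1 := by simp [stdChar, h2]
  rw [this, one_smul]
  rfl

theorem stdInvariant_isHomogeneous (i : Fin r) : ∃ k, (stdInvariant r m e i).IsHomogeneous k := by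
  unfold stdInvariant
  split_ifs
  · have h : (esymm (Fin r) ℂ (i + 1)).IsHomogeneous (i + 1) := by
      refine IsHomogeneous.sum _ _ _ fun t ht => ?_
      have := IsHomogeneous.prod t (fun j => (X j : MvPolynomial (Fin r) ℂ)) (fun _ => 1)
        fun j _ => isHomogeneous_X ℂ j
      simpa [(Finset.mem_powersetCard.1 ht).2] using this
    exact ⟨_, h.aeval _ fun i => isHomogeneous_X_pow i m⟩
  · exact ⟨_, (IsHomogeneous.prod _ _ _ fun i _ => isHomogeneous_X ℂ i).pow e⟩

/-- The monic polynomial whose roots are the variables. -/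
def rootPoly (r : ℕ) : Polynomial (MvPolynomial (Fin r) ℂ) :=
  ∏ l : Fin r, (Polynomial.X - Polynomial.C (X l))

theorem rootPoly_monic : (rootPoly r).Monic :=
  Polynomial.monic_prod_of_monic _ _ fun _ _ => Polynomial.monic_X_sub_C _

theorem natDegree_rootPoly : (rootPoly r).natDegree = r := by
  simp [rootPoly, Polynomial.natDegree_prod_of_monic _ _
    fun (l : Fin r) _ => Polynomial.monic_X_sub_C (X l : MvPolynomial (Fin r) ℂ)]

theorem rootPoly_map_eval (i : Fin r) :
    ((rootPoly r).map (expand m).toRingHom).eval (X i ^ m) = 0 := by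
  rw [rootPoly, Polynomial.map_prod, Polynomial.eval_prod]
  refine Finset.prod_eq_zero (Finset.mem_univ i) ?_
  simp

theorem rootPoly_coeff_isSymmetric (j : ℕ) : ((rootPoly r).coeff j).IsSymmetric := by
  intro π
  have h : rename π ((rootPoly r).coeff j) = ((rootPoly r).map
      (rename π : MvPolynomial (Fin r) ℂ →ₐ[ℂ] _).toRingHom).coeff j := by
    rw [Polynomial.coeff_map]; rfl
  rw [h, rootPoly, Polynomial.map_prod]
  congr 1
  rw [← Equiv.prod_comp π (fun l => Polynomial.X - Polynomial.C (X l : MvPolynomial (Fin r) ℂ))]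
  refine Finset.prod_congr rfl fun l _ => ?_
  simp

/-- The equation satisfied by the `m`-th powers of the variables over the symmetric polynomials. -/
theorem X_pow_add_sum_eq_zero (i : Fin r) :
    (X i : MvPolynomial (Fin r) ℂ) ^ (m * r) +
      ∑ n ∈ Finset.range r, expand m ((rootPoly r).coeff n) * X i ^ (m * n) = 0 := by
  have h0 := rootPoly_map_eval (m := m) i
  have hlt : ((rootPoly r).map (expand m).toRingHom).natDegree < r + 1 :=
    Nat.lt_succ_of_le (Polynomial.natDegree_map_le.trans_eq natDegree_rootPoly)
  rw [Polynomial.eval_eq_sum_range' hlt, Finset.sum_range_succ] at h0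
  have hlead : ((rootPoly r).map (expand m).toRingHom).coeff r = 1 := by
    have := (rootPoly_monic (r := r)).map ((expand m).toRingHom)
    rw [Polynomial.Monic, Polynomial.leadingCoeff, rootPoly_monic.natDegree_map,
      natDegree_rootPoly] at this
    exact this
  rw [hlead, one_mul, ← pow_mul, add_comm] at h0
  simp only [Polynomial.coeff_map, ← pow_mul] at h0
  exact h0

/-- The power x_i^m is a root of ∏ (T - x_l^m), whose coefficients are symmetric in the x_l^m. -/
theorem isIntegral_X (hr : 1 ≤ r) (hm : m = q * e) (hm0 : 0 < m) (i : Fin r) :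
    IsIntegral (Algebra.adjoin ℂ (Set.range (stdInvariant r m e)))
      (X i : MvPolynomial (Fin r) ℂ) := by
  refine IsIntegral.of_pow hm0 ?_
  have hlift : (rootPoly r).map (expand m).toRingHom ∈ Polynomial.lifts
      (algebraMap (Algebra.adjoin ℂ (Set.range (stdInvariant r m e)))
        (MvPolynomial (Fin r) ℂ)) := by
    rw [Polynomial.lifts_iff_coeff_lifts]
    intro n
    rw [Polynomial.coeff_map]
    exact ⟨⟨_, expand_mem_adjoin hr hm (rootPoly_coeff_isSymmetric n)⟩, rfl⟩
  obtain ⟨Q, hQ, -, hQm⟩ := Polynomial.lifts_and_natDegree_eq_and_monic hlift (rootPoly_monic.map _)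
  refine ⟨Q, hQm, ?_⟩
  rw [← Polynomial.eval_map, hQ, rootPoly_map_eval]

/-- The polynomial ring has transcendence degree r and is integral over the algebra generated by
these r elements, so they form a transcendence basis. -/
theorem stdInvariant_algebraicIndependent (hr : 1 ≤ r) (hm : m = q * e) (hm0 : 0 < m) :
    AlgebraicIndependent ℂ (stdInvariant r m e) := by
  have : Algebra.IsIntegral (Algebra.adjoin ℂ (Set.range (stdInvariant r m e)))
      (MvPolynomial (Fin r) ℂ) := by
    refine ⟨fun P => ?_⟩
    induction P using MvPolynomial.induction_on with
    | C c =>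
      exact isIntegral_algebraMap (R := Algebra.adjoin ℂ (Set.range (stdInvariant r m e)))
        (x := algebraMap ℂ _ c)
    | add P Q hP hQ => exact hP.add hQ
    | mul_X P i hP => exact hP.mul (isIntegral_X hr hm hm0 i)
  exact (Algebra.IsAlgebraic.isTranscendenceBasis_of_lift_le_trdeg_of_finite ℂ
    (stdInvariant r m e) (by simp)).1

/-- The fundamental invariants of `G(m, q, r)` form a stable invariant system. -/
theorem isStableInvariantSystem_stdInvariant (hr : 1 ≤ r) (hm : m = q * e) (hq : 0 < q)
    (he : 0 < e) {ζ : ℂ} (hζ : IsPrimitiveRoot ζ m) {p : ℕ}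
    (hle : monomialGroup m q r ≤ monomialGroup m p r) :
    IsStableInvariantSystem ((monomialGroup m q r).subgroupOf (monomialGroup m p r))
      (stdInvariant r m e) where
  homogeneous := stdInvariant_isHomogeneous
  algebraicIndependent :=
    stdInvariant_algebraicIndependent hr hm (hm ▸ Nat.mul_pos hq he)
  mem_adjoin_iff P :=
    ⟨fun h _ hn => invariant_of_mem_adjoin hm hq h hn,
      fun h => mem_adjoin_of_invariant hr hm hq he hζ fun g hg => h ⟨g, hle hg⟩ hg⟩
  stable g i := by
    rw [polyRep_stdInvariant g.2]
    exact Submodule.smul_mem _ _ (Submodule.subset_span ⟨i, rfl⟩)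

end Invariants

/-! ### The apolar pairing and symbols of differential operators -/

section Apolar

variable {r : ℕ}

/-- The product of the factorials of the exponents. -/
def multiFactorial (k : Fin r →₀ ℕ) : ℂ := ∏ i, ((k i).factorial : ℂ)

theorem multiFactorial_ne_zero (k : Fin r →₀ ℕ) : multiFactorial k ≠ 0 :=
  Finset.prod_ne_zero_iff.2 fun _ _ => Nat.cast_ne_zero.2 (Nat.factorial_ne_zero _)

theorem multiFactorial_add_single (k : Fin r →₀ ℕ) (i : Fin r) :
    multiFactorial (k + Finsupp.single i 1) = multiFactorial k * (k i + 1) := by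
  unfold multiFactorial
  rw [Fintype.prod_eq_mul_prod_compl i, Fintype.prod_eq_mul_prod_compl i (fun i => ((k i).factorial : ℂ))]
  have : ∀ j ∈ ({i} : Finset (Fin r))ᶜ,
      (((k + Finsupp.single i 1 : Fin r →₀ ℕ) j).factorial : ℂ) = ((k j).factorial : ℂ) := by
    intro j hj
    have hj : i ≠ j := by simpa [eq_comm] using hj
    rw [Finsupp.add_apply, Finsupp.single_eq_of_ne hj.symm, add_zero]
  rw [Finset.prod_congr rfl this]
  simp only [Finsupp.add_apply, Finsupp.single_eq_same, Nat.factorial_succ]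
  push_cast
  ring

theorem multiFactorial_mapDomain (π : Equiv.Perm (Fin r)) (k : Fin r →₀ ℕ) :
    multiFactorial (k.mapDomain π) = multiFactorial k := by
  unfold multiFactorial
  rw [← Equiv.prod_comp π]
  simp [Finsupp.mapDomain_equiv_apply]

/-- The apolar pairing of polynomials: `⟨f, g⟩ = (f(∂) g)(0)`. -/
def apolar : MvPolynomial (Fin r) ℂ →ₗ[ℂ] MvPolynomial (Fin r) ℂ →ₗ[ℂ] ℂ :=
  (basisMonomials (Fin r) ℂ).constr ℂ fun k => multiFactorial k • lcoeff ℂ k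

theorem apolar_monomial (k : Fin r →₀ ℕ) (c : ℂ) (f : MvPolynomial (Fin r) ℂ) :
    apolar (monomial k c) f = c * (multiFactorial k * coeff k f) := by
  have h : monomial k c = c • basisMonomials (Fin r) ℂ k := by
    simp [smul_monomial]
  rw [h, map_smul, apolar, Module.Basis.constr_basis]
  simp [lcoeff_apply]

theorem apolar_comm (f g : MvPolynomial (Fin r) ℂ) : apolar f g = apolar g f := by
  classical
  induction f using MvPolynomial.induction_on' with
  | add p q hp hq => rw [map_add, map_add, LinearMap.add_apply, hp, hq]
  | monomial k c =>
    induction g using MvPolynomial.induction_on' with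
    | add p q hp hq => rw [map_add, map_add, LinearMap.add_apply, hp, hq]
    | monomial l d =>
      rw [apolar_monomial, apolar_monomial, coeff_monomial, coeff_monomial]
      by_cases h : k = l
      · subst h; simp; ring
      · simp [h, Ne.symm h]

theorem eq_zero_of_apolar {f : MvPolynomial (Fin r) ℂ} (h : ∀ q, apolar q f = 0) : f = 0 := by
  ext k
  have := h (monomial k 1)
  rw [apolar_monomial, one_mul] at this
  simpa [multiFactorial_ne_zero] using this

theorem eq_of_apolar {f g : MvPolynomial (Fin r) ℂ} (h : ∀ q, apolar q f = apolar q g) :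
    f = g :=
  sub_eq_zero.1 (eq_zero_of_apolar fun q => by rw [map_sub, h, sub_self])

theorem apolar_pderiv (i : Fin r) (q f : MvPolynomial (Fin r) ℂ) :
    apolar q (pderiv i f) = apolar (X i * q) f := by
  induction q using MvPolynomial.induction_on' with
  | add p q hp hq => rw [map_add, mul_add, map_add, LinearMap.add_apply, LinearMap.add_apply, hp, hq]
  | monomial k c =>
    rw [mul_comm, X, monomial_mul, mul_one, apolar_monomial, apolar_monomial, coeff_pderiv,
      multiFactorial_add_single]
    ring

/-- Under the apolar pairing ∂_i is adjoint to multiplication by x_i, so every operator is adjoint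
to multiplication by its symbol p. With `exists_polyDiffOp` this trades operators for polynomials.
-/
theorem exists_symbol {T : Module.End ℂ (MvPolynomial (Fin r) ℂ)} (hT : T ∈ polyDiffOp r) :
    ∃ p, ∀ q f, apolar q (T f) = apolar (p * q) f := by
  induction hT using Algebra.adjoin_induction with
  | mem T hT =>
    obtain ⟨i, rfl⟩ := hT
    exact ⟨X i, fun q f => apolar_pderiv i q f⟩
  | algebraMap c =>
    refine ⟨C c, fun q f => ?_⟩
    rw [Module.algebraMap_end_apply, map_smul, ← smul_eq_C_mul, map_smul, LinearMap.smul_apply]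
  | add S T _ _ hS hT =>
    obtain ⟨p, hp⟩ := hS
    obtain ⟨p', hp'⟩ := hT
    exact ⟨p + p', fun q f => by
      rw [LinearMap.add_apply, map_add, hp, hp', add_mul, map_add, LinearMap.add_apply]⟩
  | mul S T _ _ hS hT =>
    obtain ⟨p, hp⟩ := hS
    obtain ⟨p', hp'⟩ := hT
    exact ⟨p' * p, fun q f => by rw [Module.End.mul_apply, hp, hp', mul_assoc]⟩

theorem exists_polyDiffOp (p : MvPolynomial (Fin r) ℂ) :
    ∃ T ∈ polyDiffOp r, ∀ q f, apolar q (T f) = apolar (p * q) f := by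
  induction p using MvPolynomial.induction_on with
  | C c =>
    refine ⟨algebraMap ℂ _ c, Subalgebra.algebraMap_mem _ c, fun q f => ?_⟩
    rw [Module.algebraMap_end_apply, map_smul, ← smul_eq_C_mul, map_smul, LinearMap.smul_apply]
  | add p p' hp hp' =>
    obtain ⟨S, hS, hp⟩ := hp
    obtain ⟨T, hT, hp'⟩ := hp'
    exact ⟨S + T, add_mem hS hT, fun q f => by
      rw [LinearMap.add_apply, map_add, hp, hp', add_mul, map_add, LinearMap.add_apply]⟩
  | mul_X p i hp =>
    obtain ⟨T, hT, hp⟩ := hp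
    refine ⟨T * ((pderiv i : Derivation ℂ _ _) :
      MvPolynomial (Fin r) ℂ →ₗ[ℂ] MvPolynomial (Fin r) ℂ),
      mul_mem hT (Algebra.subset_adjoin (Set.mem_range_self i)), fun q f => ?_⟩
    rw [Module.End.mul_apply, hp, Derivation.coeFn_coe, apolar_pderiv]
    ring_nf

/-- Here g' is the inverse transpose of g: the pairing identifies differential operators with
polynomials on the dual space. -/
theorem apolar_polyRep {g g' : GL (Fin r) ℂ} {π : Equiv.Perm (Fin r)} {θ : Fin r → ℂ}
    (hg : IsMonomial g π θ) (hg' : IsMonomial g' π (fun j => (θ j)⁻¹))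
    (q f : MvPolynomial (Fin r) ℂ) : apolar (polyRep r g q) (polyRep r g' f) = apolar q f := by
  induction q using MvPolynomial.induction_on' with
  | add p q hp hq => simp only [map_add, LinearMap.add_apply, hp, hq]
  | monomial k c =>
    rw [hg.polyRep_eq, hg'.polyRep_eq, scaleVars_monomial, rename_monomial, apolar_monomial,
      coeff_rename_mapDomain _ π.injective, coeff_scaleVars, apolar_monomial,
      multiFactorial_mapDomain]
    have : (∏ i, (θ i)⁻¹ ^ k i) * ∏ i, (θ i)⁻¹⁻¹ ^ k i = 1 := by
      rw [← Finset.prod_mul_distrib]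
      exact Finset.prod_eq_one fun i _ => by
        rw [← mul_pow, mul_inv_cancel₀ (inv_ne_zero (hg.ne_zero i)), one_pow]
    linear_combination (c * multiFactorial k * coeff k f) * this

end Apolar

/-! ### Harmonic polynomials as a complement of the Hilbert ideal -/

/-- The ideal generated by the `N`-invariants without constant term. -/
def invariantIdeal {r : ℕ} (N : Subgroup (GL (Fin r) ℂ)) : Ideal (MvPolynomial (Fin r) ℂ) :=
  Ideal.span {p | (∀ n ∈ N, polyRep r n p = p) ∧ constantCoeff p = 0}

section Conj

variable {r m q : ℕ}

theorem exists_conj {g : GL (Fin r) ℂ} (hg : g ∈ monomialGroup m q r) {π : Equiv.Perm (Fin r)}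
    {θ : Fin r → ℂ} (h : IsMonomial g π θ) :
    ∃ g' ∈ monomialGroup m q r, IsMonomial g' π (fun j => (θ j)⁻¹) := by
  have hh := isMonomial_monomialGL π (fun j => (θ j)⁻¹) fun j => inv_ne_zero (h.ne_zero j)
  refine ⟨_, hh.mem_monomialGroup_iff.2 ?_, hh⟩
  obtain ⟨h1, h2⟩ := h.mem_monomialGroup_iff.1 hg
  exact ⟨fun j => by rw [inv_pow, h1, inv_one], by rw [Finset.prod_inv_distrib, inv_pow, h2, inv_one]⟩

/-- Conjugating T by g replaces its symbol p by g' p, because the pairing is invariant under the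
pair (g, g'). -/
theorem symbol_invariant_iff {T : Module.End ℂ (MvPolynomial (Fin r) ℂ)}
    {p : MvPolynomial (Fin r) ℂ} (hp : ∀ q f, apolar q (T f) = apolar (p * q) f)
    {g g' : GL (Fin r) ℂ} {π : Equiv.Perm (Fin r)} {θ : Fin r → ℂ}
    (hg : IsMonomial g π θ) (hg' : IsMonomial g' π (fun j => (θ j)⁻¹)) :
    polyRep r g * T = T * polyRep r g ↔ polyRep r g' p = p := by
  have hgg : IsMonomial g π (fun j => ((fun j => (θ j)⁻¹) j)⁻¹) := by simpa using hg
  have hinv : ∀ q, polyRep r g' (polyRep r g'⁻¹ q) = q := fun q => by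
    rw [← Module.End.mul_apply, ← map_mul, mul_inv_cancel, map_one]; rfl
  have hginv : ∀ q, polyRep r g (polyRep r g⁻¹ q) = q := fun q => by
    rw [← Module.End.mul_apply, ← map_mul, mul_inv_cancel, map_one]; rfl
  have key1 : ∀ q f, apolar q (polyRep r g (T f)) =
      apolar (polyRep r g' p * q) (polyRep r g f) := fun q f => by
    conv_lhs => rw [← hinv q, apolar_polyRep hg' hgg, hp, ← apolar_polyRep hg' hgg,
      polyRep_mul_apply, hinv]
  constructor
  · intro h
    refine mul_right_cancel₀ (b := (1 : MvPolynomial (Fin r) ℂ)) one_ne_zero (eq_of_apolar fun f => ?_)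
    have := LinearMap.congr_fun h (polyRep r g⁻¹ f)
    rw [Module.End.mul_apply, Module.End.mul_apply, hginv] at this
    have h2 := key1 1 (polyRep r g⁻¹ f)
    rw [hginv, this, hp] at h2
    rw [apolar_comm, ← h2, apolar_comm]
  · intro h
    refine LinearMap.ext fun f => eq_of_apolar fun q => ?_
    rw [Module.End.mul_apply, Module.End.mul_apply, key1, h, hp]

/-- Invariant operators without constant term correspond to invariant symbols without constant term,
the group being stable under inverting all entries. Nondegeneracy of the pairing then turns T f = 0
into orthogonality to all multiples of the symbol. -/
theorem mem_harmonicPoly_iff {G : Subgroup (GL (Fin r) ℂ)} (hle : monomialGroup m q r ≤ G)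
    {f : MvPolynomial (Fin r) ℂ} :
    f ∈ harmonicPoly ((monomialGroup m q r).subgroupOf G) ↔
      ∀ j ∈ invariantIdeal (monomialGroup m q r), apolar j f = 0 := by
  have hT1 : ∀ {T : Module.End ℂ (MvPolynomial (Fin r) ℂ)} {p : MvPolynomial (Fin r) ℂ},
      (∀ q f, apolar q (T f) = apolar (p * q) f) → (T 1 = 0 ↔ constantCoeff p = 0) := by
    intro T p hp
    have h0 : ∀ h : MvPolynomial (Fin r) ℂ, apolar h 1 = constantCoeff h := fun h => by
      rw [apolar_comm, ← C_1, ← monomial_zero', apolar_monomial, constantCoeff_eq]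
      simp [multiFactorial]
    constructor
    · intro h
      have := hp 1 1
      rw [h, map_zero, mul_one, h0] at this
      exact this.symm
    · intro h
      refine eq_zero_of_apolar fun q => ?_
      rw [hp, h0, map_mul, h, zero_mul]
  constructor
  · intro hf j hj
    suffices ∀ q, apolar (q * j) f = 0 by simpa using this 1
    induction hj using Submodule.span_induction with
    | mem p hp =>
      intro q
      obtain ⟨T, hT, hTp⟩ := exists_polyDiffOp p
      have h0 : T f = 0 := by
        refine hf T hT (fun n hn => ?_) ((hT1 hTp).2 hp.2)
        obtain ⟨π, θ, hg⟩ := exists_isMonomial hn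
        obtain ⟨g', hg'm, hg'⟩ := exists_conj hn hg
        exact (symbol_invariant_iff hTp hg hg').2 (hp.1 g' hg'm)
      rw [mul_comm, ← hTp, h0, map_zero]
    | zero => simp
    | add x y _ _ hx hy =>
      intro q
      rw [mul_add, map_add, LinearMap.add_apply, hx, hy, add_zero]
    | smul c x _ hx =>
      intro q
      rw [smul_eq_mul, ← mul_assoc]
      exact hx _
  · intro h T hT hTN hT1'
    obtain ⟨p, hp⟩ := exists_symbol hT
    refine eq_zero_of_apolar fun q => ?_
    rw [hp]
    refine h _ (Ideal.mul_mem_right _ _ (Ideal.subset_span ⟨fun n hn => ?_, (hT1 hp).1 hT1'⟩))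
    obtain ⟨π, θ, hg⟩ := exists_isMonomial hn
    obtain ⟨g', hg'm, hg'⟩ := exists_conj hn hg
    have hgg : IsMonomial n π (fun j => ((fun j => (θ j)⁻¹) j)⁻¹) := by simpa using hg
    exact (symbol_invariant_iff hp hg' hgg).1 (hTN ⟨g', hle hg'm⟩ hg'm)

/-- Complex conjugation of the coefficients. -/
def conjPoly : MvPolynomial (Fin r) ℂ →+* MvPolynomial (Fin r) ℂ := map (starRingEnd ℂ)

/-- The entries are roots of unity, so their complex conjugates are their inverses and the group is
stable under conjugation. -/
theorem conjPoly_mem_invariantIdeal (hm0 : 0 < m) {f : MvPolynomial (Fin r) ℂ}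
    (hf : f ∈ invariantIdeal (monomialGroup m q r)) :
    conjPoly f ∈ invariantIdeal (monomialGroup m q r) := by
  have hle : invariantIdeal (monomialGroup m q r) ≤
      (invariantIdeal (monomialGroup m q r)).comap conjPoly := by
    refine Ideal.span_le.2 ?_
    rintro p ⟨hp, hp0⟩
    refine Ideal.subset_span ⟨fun n hn => ?_, ?_⟩
    · obtain ⟨π, θ, hg⟩ := exists_isMonomial hn
      obtain ⟨g', hg'm, hg'⟩ := exists_conj hn hg
      conv_rhs => rw [← hp g' hg'm]
      rw [hg.polyRep_eq, hg'.polyRep_eq, conjPoly, map_rename]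
      congr 1
      have hθ : ∀ i, (starRingEnd ℂ) (θ i) = (θ i)⁻¹ := fun i =>
        (Complex.inv_eq_conj (Complex.norm_eq_one_of_pow_eq_one
          ((hg.mem_monomialGroup_iff.1 hn).1 i) hm0.ne')).symm
      have : ((scaleVars fun i => (θ i)⁻¹).toRingHom.comp (map (starRingEnd ℂ))) =
          (map (starRingEnd ℂ)).comp (scaleVars fun i => (θ i)⁻¹⁻¹).toRingHom := by
        refine ringHom_ext (fun c => ?_) fun i => ?_
        · simp [scaleVars]
        · simp [scaleVars, hθ]
      exact DFunLike.congr_fun this p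
    · rw [conjPoly, constantCoeff_map, hp0, map_zero]
  exact hle hf

/-- The pairing of the conjugate of f with f is the sum of k! |f_k|² over the exponents k, a
positive definite expression. -/
theorem eq_zero_of_apolar_conj {f : MvPolynomial (Fin r) ℂ} (h : apolar (conjPoly f) f = 0) :
    f = 0 := by
  have key : ∀ (p : MvPolynomial (Fin r) ℂ), apolar p f =
      ∑ k ∈ p.support, coeff k p * (multiFactorial k * coeff k f) := fun p => by
    conv_lhs => rw [p.as_sum, map_sum, LinearMap.sum_apply]
    simp only [apolar_monomial]
  have h2 : (∑ k ∈ (conjPoly f).support,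
      (∏ i, ((k i).factorial : ℝ)) * Complex.normSq (coeff k f)) = 0 := by
    rw [key] at h
    rw [← Complex.ofReal_eq_zero, ← h]
    push_cast
    refine Finset.sum_congr rfl fun k _ => ?_
    rw [conjPoly, coeff_map, Complex.normSq_eq_conj_mul_self, multiFactorial]
    ring
  rw [Finset.sum_eq_zero_iff_of_nonneg fun k _ => by
    have := Complex.normSq_nonneg (coeff k f)
    positivity] at h2
  ext k
  rw [coeff_zero]
  by_contra hk
  have hk' : k ∈ (conjPoly f).support := by
    rw [mem_support_iff, conjPoly, coeff_map]
    simpa using hk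
  have h3 := h2 k hk'
  have h4 : (∏ i, ((k i).factorial : ℝ)) ≠ 0 :=
    Finset.prod_ne_zero_iff.2 fun _ _ => Nat.cast_ne_zero.2 (Nat.factorial_ne_zero _)
  exact hk (Complex.normSq_eq_zero.1 ((mul_eq_zero.1 h3).resolve_left h4))

/-- A high power of each variable lies in the Hilbert ideal. -/
theorem X_pow_mem_invariantIdeal (hm0 : 0 < m) (i : Fin r) :
    (X i : MvPolynomial (Fin r) ℂ) ^ (m * r) ∈ invariantIdeal (monomialGroup m q r) := by
  rw [eq_neg_of_add_eq_zero_left (X_pow_add_sum_eq_zero i)]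
  refine neg_mem (Ideal.sum_mem _ fun n hn => Ideal.mul_mem_right _ _ ?_)
  refine Ideal.subset_span ⟨fun g hg => ?_, ?_⟩
  · obtain ⟨π, θ, h⟩ := exists_isMonomial hg
    rw [h.polyRep_expand (h.mem_monomialGroup_iff.1 hg).1, rootPoly_coeff_isSymmetric]
  · have h1 : (constantCoeff : MvPolynomial (Fin r) ℂ →+* ℂ) 
      ((rootPoly r).coeff n) = 0 := by
      rw [← Polynomial.coeff_map, rootPoly, Polynomial.map_prod]
      simp [Polynomial.coeff_X_pow, (Finset.mem_range.1 hn).ne]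
    rwa [constantCoeff_eq, coeff_expand_zero m hm0.ne', ← constantCoeff_eq]

/-- The polynomials all of whose exponents are at most `K`. -/
def boundedPoly (r K : ℕ) : Submodule ℂ (MvPolynomial (Fin r) ℂ) :=
  Submodule.span ℂ ((fun k => monomial k (1 : ℂ)) ''
    Set.Iic (Finsupp.equivFunOnFinite.symm fun _ => K))

instance (r K : ℕ) : FiniteDimensional ℂ (boundedPoly r K) :=
  FiniteDimensional.span_of_finite ℂ ((Set.finite_Iic _).image _)

/-- A monomial with an exponent above mr lies in the Hilbert ideal and is orthogonal to all bounded
polynomials. This reduces the decomposition to a finite-dimensional space. -/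
theorem exists_bounded_add (hm0 : 0 < m) (f : MvPolynomial (Fin r) ℂ) :
    ∃ w ∈ boundedPoly r (m * r), ∃ h ∈ invariantIdeal (monomialGroup m q r),
      f = w + h ∧ ∀ v ∈ boundedPoly r (m * r), apolar h v = 0 := by
  classical
  induction f using MvPolynomial.induction_on' with
  | monomial k c =>
    by_cases hk : ∀ i, k i ≤ m * r
    · refine ⟨monomial k c, ?_, 0, zero_mem _, (add_zero _).symm, by simp⟩
      rw [show monomial k c = c • monomial k (1 : ℂ) by rw [smul_monomial, smul_eq_mul, mul_one]]
      exact Submodule.smul_mem _ _ (Submodule.subset_span ⟨k, hk, rfl⟩)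
    · push Not at hk
      obtain ⟨i, hi⟩ := hk
      refine ⟨0, zero_mem _, monomial k c, ?_, (zero_add _).symm, fun v hv => ?_⟩
      · rw [monomial_eq, Finsupp.prod_fintype _ _ (by simp)]
        refine Ideal.mul_mem_left _ _ (Ideal.mem_of_dvd _
          (Finset.dvd_prod_of_mem _ (Finset.mem_univ i)) ?_)
        exact Ideal.mem_of_dvd _ (pow_dvd_pow _ hi.le) (X_pow_mem_invariantIdeal hm0 i)
      · induction hv using Submodule.span_induction with
        | mem v hv =>
          obtain ⟨l, hl, rfl⟩ := hv
          have : l ≠ k := fun h => by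
            subst h
            exact absurd (hl i) (not_le.2 hi)
          rw [apolar_monomial, coeff_monomial, if_neg this, mul_zero, mul_zero]
        | zero => simp
        | add x y _ _ hx hy => rw [map_add, hx, hy, add_zero]
        | smul c x _ hx => rw [map_smul, hx, smul_zero]
  | add p p' hp hp' =>
    obtain ⟨w, hw, h, hh, rfl, hv⟩ := hp
    obtain ⟨w', hw', h', hh', rfl, hv'⟩ := hp'
    exact ⟨w + w', add_mem hw hw', h + h', add_mem hh hh', by ring, fun v hvm => by
      rw [map_add, LinearMap.add_apply, hv v hvm, hv' v hvm, add_zero]⟩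

/-- Positivity, together with stability of the ideal under conjugation, makes the intersection zero.
For the sum, let U be the part of the ideal inside the bounded polynomials: U meets its orthogonal
trivially, so in finite dimension they are complementary, and the orthogonal of U is harmonic
because the unbounded part of the ideal does not pair with it. -/
theorem isCompl_invariantIdeal (hm0 : 0 < m) {G : Subgroup (GL (Fin r) ℂ)}
    (hle : monomialGroup m q r ≤ G) :
    IsCompl (harmonicPoly ((monomialGroup m q r).subgroupOf G))
      ((invariantIdeal (monomialGroup m q r)).restrictScalars ℂ) := by
  let W := boundedPoly r (m * r)
  let J := (invariantIdeal (monomialGroup m q r)).restrictScalars ℂ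
  let B : LinearMap.BilinForm ℂ W := (apolar (r := r)).domRestrict₁₂ W W
  have hB : ∀ u v : W, B u v = apolar (u : MvPolynomial (Fin r) ℂ) v := fun _ _ => rfl
  let U : Submodule ℂ W := J.comap W.subtype
  have hrefl : B.IsRefl := fun u v h => by rw [hB, apolar_comm]; exact h
  have hharm : ∀ w : W, w ∈ B.orthogonal U →
      (w : MvPolynomial (Fin r) ℂ) ∈ harmonicPoly ((monomialGroup m q r).subgroupOf G) := by
    intro w hw
    rw [mem_harmonicPoly_iff hle]
    intro j hj
    obtain ⟨w', hw', h, hh, rfl, hv⟩ := exists_bounded_add (q := q) hm0 j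
    have hw'J : w' ∈ J := by
      have := sub_mem hj hh
      rwa [add_sub_cancel_right] at this
    rw [map_add, LinearMap.add_apply, hv w w.2, add_zero]
    exact hw ⟨w', hw'⟩ hw'J
  have hdisj : Disjoint (harmonicPoly ((monomialGroup m q r).subgroupOf G)) J := by
    rw [Submodule.disjoint_def]
    intro f hf hfJ
    exact eq_zero_of_apolar_conj
      ((mem_harmonicPoly_iff hle).1 hf _ (conjPoly_mem_invariantIdeal hm0 hfJ))
  refine ⟨hdisj, ?_⟩
  have hU : IsCompl U (B.orthogonal U) := by
    rw [LinearMap.BilinForm.isCompl_orthogonal_iff_disjoint hrefl, Submodule.disjoint_def]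
    intro w hw hw'
    exact Subtype.ext ((Submodule.disjoint_def.1 hdisj) w (hharm w hw') hw)
  rw [codisjoint_iff, eq_top_iff]
  intro f _
  obtain ⟨w, hw, h, hh, rfl, -⟩ := exists_bounded_add (q := q) hm0 f
  refine add_mem ?_ (Submodule.mem_sup_right hh)
  have : (⟨w, hw⟩ : W) ∈ U ⊔ B.orthogonal U := by rw [hU.sup_eq_top]; trivial
  obtain ⟨u, hu, v, hv, huv⟩ := Submodule.mem_sup.1 this
  have h2 : w = u + v := (congrArg Subtype.val huv).symm
  rw [h2]
  exact add_mem (Submodule.mem_sup_right hu) (Submodule.mem_sup_left (hharm v hv))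

end Conj

/-! ### Permutation-equivariant families of polynomials -/

section CosetSum

variable {r : ℕ}

/-- The sum of the images of `p` under the permutations of the variables which map `i₀` to a
given index. -/
def cosetSum (i₀ : Fin r) : MvPolynomial (Fin r) ℂ →ₗ[ℂ] Fin r → MvPolynomial (Fin r) ℂ :=
  LinearMap.pi fun i => ∑ π : Equiv.Perm (Fin r) with π i₀ = i, (rename π).toLinearMap

theorem cosetSum_apply (i₀ i : Fin r) (p : MvPolynomial (Fin r) ℂ) :
    cosetSum i₀ p i = ∑ π : Equiv.Perm (Fin r) with π i₀ = i, rename π p := by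
  simp [cosetSum]

theorem cosetSum_X_pow_mul (i₀ i : Fin r) (n : ℕ) (p : MvPolynomial (Fin r) ℂ) :
    cosetSum i₀ (X i₀ ^ n * p) i = X i ^ n * cosetSum i₀ p i := by
  rw [cosetSum_apply, cosetSum_apply, Finset.mul_sum]
  refine Finset.sum_congr rfl fun π hπ => ?_
  rw [map_mul, map_pow, rename_X, (Finset.mem_filter.1 hπ).2]

/-- Every π occurs exactly once, for a = π⁻¹(i). The total does not depend on i, so it is a constant
family with a symmetric value. -/
theorem sum_cosetSum (i₀ i : Fin r) (p : MvPolynomial (Fin r) ℂ) :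
    ∑ a, cosetSum i₀ (rename (Equiv.swap i₀ a) p) i =
      ∑ π : Equiv.Perm (Fin r), rename π p := by
  have h : ∀ a, cosetSum i₀ (rename (Equiv.swap i₀ a) p) i =
      ∑ π : Equiv.Perm (Fin r) with π⁻¹ i = a, rename π p := by
    intro a
    rw [cosetSum_apply]
    refine Finset.sum_nbij' (· * Equiv.swap i₀ a) (· * Equiv.swap i₀ a) ?_ ?_ ?_ ?_ ?_
    · intro π hπ
      simp only [Finset.mem_filter, Finset.mem_univ, true_and] at hπ ⊢
      rw [Equiv.Perm.inv_eq_iff_eq, Equiv.Perm.mul_apply, Equiv.swap_apply_right, hπ]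
    · intro π hπ
      simp only [Finset.mem_filter, Finset.mem_univ, true_and] at hπ ⊢
      rw [Equiv.Perm.mul_apply, Equiv.swap_apply_left, ← hπ]
      exact π.apply_symm_apply i
    · intro π _
      simp [mul_assoc]
    · intro π _
      simp [mul_assoc]
    · intro π _
      rw [rename_rename]
      rfl
  simp only [h]
  exact Finset.sum_fiberwise _ _ _

/-- An equivariant family is determined by its member at i₀. The scalar is the order of the
stabiliser of i₀, and every coset has that many elements. -/
theorem cosetSum_eq_smul {i₀ : Fin r} {F : Fin r → MvPolynomial (Fin r) ℂ}
    (hF : ∀ (π : Equiv.Perm (Fin r)) i, rename π (F i) = F (π i)) :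
    ∃ c : ℂ, c ≠ 0 ∧ cosetSum i₀ (F i₀) = c • F := by
  refine ⟨((Finset.univ.filter fun π : Equiv.Perm (Fin r) => π i₀ = i₀).card : ℂ), ?_, ?_⟩
  · exact Nat.cast_ne_zero.2 (Finset.card_ne_zero_of_mem (a := 1) (by simp))
  · funext i
    rw [cosetSum_apply, Finset.sum_congr rfl (g := fun _ => F i) fun π hπ => by
      rw [hF, (Finset.mem_filter.1 hπ).2], Finset.sum_const, Pi.smul_apply, Nat.cast_smul_eq_nsmul]
    congr 1
    refine Finset.card_nbij' (Equiv.swap i i₀ * ·) (Equiv.swap i i₀ * ·) ?_ ?_ ?_ ?_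
    · intro π hπ
      simp only [Finset.coe_filter, Finset.mem_univ, true_and, Set.mem_ofPred_eq] at hπ ⊢
      rw [Equiv.Perm.mul_apply, hπ, Equiv.swap_apply_left]
    · intro π hπ
      simp only [Finset.coe_filter, Finset.mem_univ, true_and, Set.mem_ofPred_eq] at hπ ⊢
      rw [Equiv.Perm.mul_apply, hπ, Equiv.swap_apply_right]
    · intro π _
      simp [← mul_assoc]
    · intro π _
      simp [← mul_assoc]

/-- The families `i ↦ H (x_i)` for polynomials `H` with symmetric coefficients. -/
def symmetricFamilies (r : ℕ) :
    Submodule (symmetricSubalgebra (Fin r) ℂ) (Fin r → MvPolynomial (Fin r) ℂ) :=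
  Submodule.span _ (Set.range fun (n : ℕ) i => X i ^ n)

theorem X_pow_mul_mem_symmetricFamilies {F : Fin r → MvPolynomial (Fin r) ℂ}
    (hF : F ∈ symmetricFamilies r) (n : ℕ) :
    (fun i => X i ^ n * F i) ∈ symmetricFamilies r := by
  induction hF using Submodule.span_induction with
  | mem F hF =>
    obtain ⟨k, rfl⟩ := hF
    exact Submodule.subset_span ⟨n + k, funext fun i => pow_add _ _ _⟩
  | zero => simp only [Pi.zero_apply, mul_zero]; exact Submodule.zero_mem (symmetricFamilies r)
  | add F F' _ _ hF hF' =>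
    simp only [Pi.add_apply, mul_add]
    exact add_mem hF hF'
  | smul c F _ hF =>
    simp only [Pi.smul_apply, mul_smul_comm]
    exact Submodule.smul_mem _ c hF

theorem monomial_eq_X_pow_mul (i : Fin r) (l : Fin r →₀ ℕ) :
    monomial l (1 : ℂ) = X i ^ l i * monomial (l.erase i) 1 := by
  rw [X_pow_eq_monomial, monomial_mul, one_mul, Finsupp.single_add_erase]

/-- Powers of the variable at i₀ can be pulled out, so induction runs on the number of other
variables occurring. By `sum_cosetSum`, the sum over all transpositions (i₀ a) is a symmetric
multiple of the constant family 1. The terms with a not occurring all equal the wanted one; in the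
others x_a moves to position i₀ and is pulled out, leaving fewer variables. -/
theorem cosetSum_monomial_mem (i₀ : Fin r) (l : Fin r →₀ ℕ) :
    cosetSum i₀ (monomial l 1) ∈ symmetricFamilies r := by
  classical
  suffices ∀ n, ∀ l : Fin r →₀ ℕ, l i₀ = 0 → l.support.card = n →
      cosetSum i₀ (monomial l 1) ∈ symmetricFamilies r by
    rw [monomial_eq_X_pow_mul i₀]
    convert X_pow_mul_mem_symmetricFamilies
      (this _ (l.erase i₀) Finsupp.erase_same rfl) (l i₀) using 1
    funext i
    exact cosetSum_X_pow_mul _ _ _ _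
  intro n
  induction n using Nat.strong_induction_on with
  | _ n ih =>
  intro l hl hn
  have h1 : ∀ a, l a = 0 →
      cosetSum i₀ (rename (Equiv.swap i₀ a) (monomial l 1)) = cosetSum i₀ (monomial l (1 : ℂ)) := by
    intro a ha
    have h : l.mapDomain (Equiv.swap i₀ a) = l := by
      refine Finsupp.ext fun b => ?_
      rw [Finsupp.mapDomain_equiv_apply, Equiv.symm_swap, Equiv.swap_apply_def]
      split_ifs with h h'
      · rw [h, ha, hl]
      · rw [h', ha, hl]
      · rfl
    rw [rename_monomial, h]
  have h2 : ∀ a, l a ≠ 0 →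
      cosetSum i₀ (rename (Equiv.swap i₀ a) (monomial l (1 : ℂ))) ∈ symmetricFamilies r := by
    intro a ha
    rw [rename_monomial, monomial_eq_X_pow_mul i₀]
    set l' := l.mapDomain (Equiv.swap i₀ a) with hl'
    have hcard : (l'.erase i₀).support.card < n := by
      have hsupp : l'.support.card = n := by
        rw [hl', Finsupp.mapDomain_support_of_injective (Equiv.injective _), ← hn,
          Finset.card_image_of_injective _ (Equiv.injective _)]
      rw [Finsupp.support_erase, ← hsupp]
      refine Finset.card_erase_lt_of_mem ?_
      rw [Finsupp.mem_support_iff, hl', Finsupp.mapDomain_equiv_apply, Equiv.symm_swap,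
        Equiv.swap_apply_left]
      exact ha
    convert X_pow_mul_mem_symmetricFamilies
      (ih _ hcard (l'.erase i₀) Finsupp.erase_same rfl) (l' i₀) using 1
    funext i
    exact cosetSum_X_pow_mul _ _ _ _
  have h3 : ((Finset.univ.filter fun a => l a = 0).card : ℂ) • cosetSum i₀ (monomial l (1 : ℂ)) =
      (⟨_, isSymmetric_sum_rename (monomial l 1)⟩ : symmetricSubalgebra (Fin r) ℂ) •
        (fun i => X i ^ 0) -
      ∑ a with ¬ l a = 0, cosetSum i₀ (rename (Equiv.swap i₀ a) (monomial l (1 : ℂ))) := by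
    rw [eq_sub_iff_add_eq, Nat.cast_smul_eq_nsmul, ← Finset.sum_const,
      Finset.sum_congr rfl fun a ha => (h1 a (Finset.mem_filter.1 ha).2).symm,
      Finset.sum_filter_add_sum_filter_not]
    funext i
    rw [Finset.sum_apply, sum_cosetSum, Pi.smul_apply, pow_zero, Subalgebra.smul_def, smul_eq_mul,
      mul_one]
  -- The index a = i₀ itself is counted, so the number of equal terms is nonzero.
  have hc : ((Finset.univ.filter fun a => l a = 0).card : ℂ) ≠ 0 :=
    Nat.cast_ne_zero.2 (Finset.card_ne_zero_of_mem (a := i₀) (by simp [hl]))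
  have hsm : ∀ (c : ℂ) {F : Fin r → MvPolynomial (Fin r) ℂ}, F ∈ symmetricFamilies r →
      c • F ∈ symmetricFamilies r := fun c F hF => by
    convert Submodule.smul_mem _ (algebraMap ℂ (symmetricSubalgebra (Fin r) ℂ) c) hF using 1
    rw [algebraMap_smul]
  rw [← inv_smul_smul₀ hc (cosetSum i₀ (monomial l (1 : ℂ))), h3]
  refine hsm _ (sub_mem (Submodule.smul_mem _ _ (Submodule.subset_span ⟨0, rfl⟩))
    (sum_mem fun a ha => h2 a (Finset.mem_filter.1 ha).2))

end CosetSum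

/-! ### The free module of covariants -/

/-- The families `x_i^s ω_{j,i}`, where the `ω_j` are the fundamental covariants. -/
def shiftedCovariant (r m e C : ℕ) (j i : Fin r) : MvPolynomial (Fin r) ℂ :=
  if (j : ℕ) + 1 < r then X i ^ (m * (j + 1)) else (∏ l, X l) ^ (e * C)

section Covariants

variable {r m q e C s : ℕ}

local notation "invRing" => Algebra.adjoin ℂ (Set.range (stdInvariant r m e))

local notation "covModule" => Submodule.span (Algebra.adjoin ℂ (Set.range (stdInvariant r m e)))
  (Set.range (shiftedCovariant r m e C))

theorem prod_pow_mem_covModule (hr : 1 ≤ r) : (fun _ => (∏ l, X l) ^ (e * C)) ∈ covModule := by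
  refine Submodule.subset_span ⟨⟨r - 1, by omega⟩, ?_⟩
  funext i
  rw [shiftedCovariant, if_neg (by simp; omega)]

theorem mul_mem_covModule {h : MvPolynomial (Fin r) ℂ} (hh : h ∈ invRing)
    {F : Fin r → MvPolynomial (Fin r) ℂ} (hF : F ∈ covModule) :
    (fun i => h * F i) ∈ covModule :=
  Submodule.smul_mem _ (⟨h, hh⟩ : invRing) hF

/-- Exponents from mr on are lowered by the equation of x_i^m over the symmetric polynomials. -/
theorem X_pow_mem_covModule (hr : 1 ≤ r) (hm : m = q * e) (hC : C ≤ q) (n : ℕ) :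
    (fun i => X i ^ (m * (n + 1))) ∈ covModule := by
  induction n using Nat.strong_induction_on with
  | _ n ih =>
  by_cases hn : n + 1 < r
  · refine Submodule.subset_span ⟨⟨n, by omega⟩, ?_⟩
    funext i
    rw [shiftedCovariant, if_pos hn]
  have hF : (fun i : Fin r => (X i : MvPolynomial (Fin r) ℂ) ^ (m * (n + 1))) =
      -∑ k ∈ Finset.range r, fun i =>
        expand m ((rootPoly r).coeff k) *
          X i ^ (m * (k + (n + 1 - r))) := by
    funext i
    rw [Pi.neg_apply, Finset.sum_apply]
    have h := X_pow_add_sum_eq_zero (m := m) i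
    have hexp : n + 1 = r + (n + 1 - r) := by omega
    rw [hexp, Nat.add_sub_cancel_left, mul_add, pow_add, eq_neg_of_add_eq_zero_left h, neg_mul,
      Finset.sum_mul, neg_inj]
    refine Finset.sum_congr rfl fun k _ => ?_
    rw [mul_add m k, pow_add, mul_assoc]
  rw [hF]
  refine neg_mem (sum_mem fun k hk => ?_)
  have hkr := Finset.mem_range.1 hk
  -- Only the constant coefficient ±(x_1 ⋯ x_r)^m can leave a term without x_i; it is an invariant
  -- multiple of the last generator because C ≤ q.
  by_cases h0 : k + (n + 1 - r) = 0
  · have hk0 : k = 0 := by omega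
    rw [h0, hk0, rootPoly, Polynomial.coeff_zero_eq_eval_zero, Polynomial.eval_prod]
    simp only [Polynomial.eval_sub, Polynomial.eval_X, Polynomial.eval_C, zero_sub, mul_zero,
      pow_zero, mul_one]
    have h1 : (fun _ : Fin r => expand m (∏ l : Fin r, -(X l : MvPolynomial (Fin r) ℂ))) =
        fun _ : Fin r => ((-1) ^ r * ((∏ l, X l) ^ e) ^ (q - C)) * (∏ l, X l) ^ (e * C) := by
      funext _
      rw [Finset.prod_neg, map_mul, expand_prod_X hm, mul_assoc, pow_mul, ← pow_add,
        Nat.sub_add_cancel hC]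
      simp
    rw [h1]
    exact mul_mem_covModule (mul_mem (pow_mem (neg_mem (one_mem _)) _)
      (pow_mem (prod_X_mem_adjoin hr) _)) (prod_pow_mem_covModule hr)
  · obtain ⟨k', hk'⟩ := Nat.exists_eq_succ_of_ne_zero h0
    rw [hk']
    exact mul_mem_covModule (expand_mem_adjoin hr hm (rootPoly_coeff_isSymmetric k))
      (ih k' (by omega))

theorem mul_expand_mem_covModule (hr : 1 ≤ r) (hm : m = q * e)
    {u : Fin r → MvPolynomial (Fin r) ℂ} (hu : ∀ n, (fun i => u i * X i ^ (m * n)) ∈ covModule)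
    {F : Fin r → MvPolynomial (Fin r) ℂ} (hF : F ∈ symmetricFamilies r) :
    (fun i => u i * expand m (F i)) ∈ covModule := by
  induction hF using Submodule.span_induction with
  | mem F hF =>
    obtain ⟨k, rfl⟩ := hF
    convert hu k using 2
    rw [map_pow, expand_X, pow_mul]
  | zero => simp only [Pi.zero_apply, map_zero, mul_zero]; exact Submodule.zero_mem covModule
  | add F F' _ _ hF hF' =>
    simp only [Pi.add_apply, map_add, mul_add]
    exact add_mem hF hF'
  | smul c F _ hF =>
    simp only [Pi.smul_apply, Subalgebra.smul_def, smul_eq_mul, map_mul, mul_left_comm (u _)]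
    exact mul_mem_covModule (expand_mem_adjoin hr hm c.2) hF

/-- The family is recovered from its member at i₀ by summing over cosets, so one monomial of that
member can be treated at a time. It equals (x_1 ⋯ x_r)^{ec} times a monomial in the x_i^m, and the
argument splits at c = C. -/
theorem mem_covModule (hr : 1 ≤ r) (hm : m = q * e) (hq : 0 < q) (he : 0 < e) {ζ : ℂ}
    (hζ : IsPrimitiveRoot ζ m) (hC : C ≤ q) (hCs : ∀ c < C, e * c < s)
    {F : Fin r → MvPolynomial (Fin r) ℂ}
    (hF : ∀ g ∈ monomialGroup m q r, ∀ π θ, IsMonomial g π θ → ∀ i, polyRep r g (F i) = F (π i))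
    (hs : ∀ i k, coeff k (F i) ≠ 0 → s ≤ k i) : F ∈ covModule := by
  have hm0 : 0 < m := hm ▸ Nat.mul_pos hq he
  have hmq : m / q = e := by rw [hm, Nat.mul_div_cancel_left _ hq]
  let i₀ : Fin r := ⟨0, hr⟩
  have hsm : ∀ (c : ℂ) {F : Fin r → MvPolynomial (Fin r) ℂ}, F ∈ covModule →
      c • F ∈ covModule := fun c F hF => by
    convert Submodule.smul_mem _ (algebraMap ℂ invRing c) hF using 1
    rw [algebraMap_smul]
  obtain ⟨c, hc, hcF⟩ := cosetSum_eq_smul (i₀ := i₀) (F := F) fun π i => by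
    rw [← polyRep_perm]
    exact hF _ monomialGL_one_mem π 1 (isMonomial_monomialGL _ _ _) i
  rw [← inv_smul_smul₀ hc F, ← hcF]
  refine hsm _ ?_
  have hsum : cosetSum i₀ (F i₀) =
      ∑ k ∈ (F i₀).support, coeff k (F i₀) • cosetSum i₀ (monomial k (1 : ℂ)) := by
    conv_lhs => rw [(F i₀).as_sum, map_sum]
    refine Finset.sum_congr rfl fun k _ => ?_
    rw [← map_smul, smul_monomial, smul_eq_mul, mul_one]
  rw [hsum]
  refine sum_mem fun k hk => hsm _ ?_
  rw [mem_support_iff] at hk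
  obtain ⟨c, hc, hkc⟩ := modEq_of_torus hr hm hq he hζ (K := k) fun θ h1 h2 => by
    have hθ : ∀ j, θ j ≠ 0 := fun j h => by
      have := h1 j
      rw [h, zero_pow hm0.ne'] at this
      exact zero_ne_one this
    have hg := isMonomial_monomialGL 1 θ hθ
    have := hg.prod_pow_eq_one_of_coeff_ne_zero (c := 1) (P := F i₀)
      (by rw [C_1, one_mul]
          exact hF _ (hg.mem_monomialGroup_iff.2 ⟨h1, by rw [hmq, h2]⟩) 1 θ hg i₀) hk
    rwa [one_mul] at this
  obtain ⟨l, hkl, hl⟩ := monomial_eq_mul_expand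
    (by rw [hm, mul_comm q]; exact Nat.mul_lt_mul_of_pos_left hc he) hkc
  have key : ∀ (n : ℕ) (p : MvPolynomial (Fin r) ℂ),
      cosetSum i₀ ((∏ i, X i) ^ n * expand m p) =
        fun i => (∏ i, X i) ^ n * expand m (cosetSum i₀ p i) := by
    intro n p
    funext i
    rw [cosetSum_apply, cosetSum_apply, map_sum, Finset.mul_sum]
    refine Finset.sum_congr rfl fun π _ => ?_
    rw [map_mul, map_pow, rename_prod_X, rename_expand]
  rw [hl, key]
  have hprod : ∀ n, (∏ i, X i) ^ (e * n) ∈ invRing := fun n => by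
    rw [pow_mul]
    exact pow_mem (prod_X_mem_adjoin hr) n
  by_cases hcC : c < C
  · have hl0 : l i₀ ≠ 0 := by
      intro h0
      have h1 := hs i₀ k hk
      rw [hkl, h0, mul_zero, add_zero] at h1
      exact absurd (hCs c hcC) (not_lt.2 h1)
    obtain ⟨n, hn⟩ := Nat.exists_eq_succ_of_ne_zero hl0
    have h1 : (fun i => X i ^ m * expand m (X i ^ n * cosetSum i₀ (monomial (l.erase i₀) 1) i))
        ∈ covModule :=
      mul_expand_mem_covModule hr hm (u := fun i => X i ^ m)
        (fun n' => by
          convert X_pow_mem_covModule (C := C) hr hm hC n' using 2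
          ring)
        (X_pow_mul_mem_symmetricFamilies (cosetSum_monomial_mem i₀ (l.erase i₀)) n)
    convert mul_mem_covModule (hprod c) h1 using 2 with i
    rw [monomial_eq_X_pow_mul i₀ l, cosetSum_X_pow_mul, hn, map_mul, map_mul, map_pow, map_pow,
      expand_X, pow_succ]
    ring
  · have h1 : (fun i => (∏ l, X l) ^ (e * C) * expand m (cosetSum i₀ (monomial l 1) i))
        ∈ covModule := by
      refine mul_expand_mem_covModule hr hm (u := fun _ => (∏ l, X l) ^ (e * C)) (fun n => ?_)
        (cosetSum_monomial_mem i₀ l)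
      cases n with
      | zero =>
        simp only [mul_zero, pow_zero, mul_one]
        exact prod_pow_mem_covModule hr
      | succ n => exact mul_mem_covModule (hprod C) (X_pow_mem_covModule hr hm hC n)
    convert mul_mem_covModule (hprod (c - C)) h1 using 2 with i
    rw [← mul_assoc, ← pow_add, ← mul_add, Nat.sub_add_cancel (not_lt.1 hcC)]

/-- The fundamental covariants: the coordinates of a basis of the `N`-invariants in
`S(V^*) ⊗ (V^σ)^*` over the `N`-invariants in `S(V^*)`. -/
def fundCovariant (r m e C s : ℕ) (j i : Fin r) : MvPolynomial (Fin r) ℂ :=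
  if (j : ℕ) + 1 < r then X i ^ (m * (j + 1) - s)
  else X i ^ (e * C - s) * ∏ l ∈ Finset.univ.erase i, X l ^ (e * C)

theorem X_pow_mul_fundCovariant (hsm : s ≤ m) (hsC : s ≤ e * C) (j i : Fin r) :
    X i ^ s * fundCovariant r m e C s j i = shiftedCovariant r m e C j i := by
  unfold fundCovariant shiftedCovariant
  split_ifs
  · rw [← pow_add, Nat.add_sub_cancel']
    exact hsm.trans (Nat.le_mul_of_pos_right m (Nat.succ_pos _))
  · rw [← mul_assoc, ← pow_add, Nat.add_sub_cancel' hsC, Finset.mul_prod_erase Finset.univ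
      (fun l => (X l : MvPolynomial (Fin r) ℂ) ^ (e * C)) (Finset.mem_univ i),
      Finset.prod_pow]

theorem IsMonomial.polyRep_X {g : GL (Fin r) ℂ} {π : Equiv.Perm (Fin r)} {θ : Fin r → ℂ}
    (hg : IsMonomial g π θ) (i : Fin r) : polyRep r g (X i) = MvPolynomial.C (θ i)⁻¹ * X (π i) := by
  rw [hg.polyRep_eq]
  simp [scaleVars]

theorem IsMonomial.polyRep_X_pow {g : GL (Fin r) ℂ} {π : Equiv.Perm (Fin r)} {θ : Fin r → ℂ}
    (hg : IsMonomial g π θ) (i : Fin r) (n : ℕ) :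
    polyRep r g (X i ^ n) = MvPolynomial.C (θ i ^ n)⁻¹ * X (π i) ^ n := by
  have := congrArg (· ^ n) (hg.polyRep_X i)
  simp only [mul_pow, ← C_pow, inv_pow] at this
  rw [← this, polyRep_apply, map_pow]
  rfl

/-- After multiplication by x_i^s the twist by θ_i^s disappears, leaving a permutation of the
members and a character; the power of x_i is then cancelled. -/
theorem polyRep_fundCovariant (hsm : s ≤ m) (hsC : s ≤ e * C) {p : ℕ} {g : GL (Fin r) ℂ}
    (hgm : g ∈ monomialGroup m p r) {π : Equiv.Perm (Fin r)} {θ : Fin r → ℂ}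
    (hg : IsMonomial g π θ) (j i : Fin r) :
    polyRep r g (fundCovariant r m e C s j i) = MvPolynomial.C (θ i ^ s) *
      (stdChar e (entryProd g ^ C) j • fundCovariant r m e C s j (π i)) := by
  have hθ : θ i ^ s ≠ 0 := pow_ne_zero _ (hg.ne_zero i)
  have h1 : polyRep r g (shiftedCovariant r m e C j i) =
      stdChar e (entryProd g ^ C) j • shiftedCovariant r m e C j (π i) := by
    unfold shiftedCovariant stdChar
    split_ifs
    · rw [hg.polyRep_X_pow, pow_mul (θ i), (hg.mem_monomialGroup_iff.1 hgm).1, one_pow, inv_one,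
        C_1, one_mul, one_smul]
    · rw [polyRep_apply, map_pow, ← polyRep_apply, hg.polyRep_prod_X, mul_pow, ← C_pow, inv_pow,
        smul_eq_C_mul, ← pow_mul, mul_comm C e]
  rw [← X_pow_mul_fundCovariant hsm hsC, ← X_pow_mul_fundCovariant hsm hsC, polyRep_mul_apply,
    hg.polyRep_X_pow] at h1
  have hX : MvPolynomial.C (θ i ^ s)⁻¹ * (X (π i) : MvPolynomial (Fin r) ℂ) ^ s ≠ 0 :=
    mul_ne_zero (by simp [hg.ne_zero i]) (pow_ne_zero _ (X_ne_zero _))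
  refine mul_left_cancel₀ hX (h1.trans ?_)
  have hC1 : MvPolynomial.C (σ := Fin r) (θ i ^ s)⁻¹ * MvPolynomial.C (θ i ^ s) = 1 := by
    rw [← C_mul, inv_mul_cancel₀ hθ, C_1]
  rw [smul_eq_C_mul, smul_eq_C_mul]
  linear_combination (-(X (π i) ^ s * MvPolynomial.C (stdChar e (entryProd g ^ C) j) *
    fundCovariant r m e C s j (π i))) * hC1

/-- A Vandermonde argument: after multiplication by x_i^s, a relation is a polynomial of degree less
than r vanishing at the r distinct elements x_i^m. -/
theorem fundCovariant_linearIndependent (hm0 : 0 < m) (hsm : s ≤ m) (hsC : s ≤ e * C)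
    {h : Fin r → MvPolynomial (Fin r) ℂ}
    (h0 : ∀ i, ∑ j, h j * fundCovariant r m e C s j i = 0) (j : Fin r) : h j = 0 := by
  have h1 : ∀ i, ∑ j, h j * shiftedCovariant r m e C j i = 0 := by
    intro i
    have := congrArg (X i ^ s * ·) (h0 i)
    simp only [Finset.mul_sum, mul_zero] at this
    rw [← this]
    refine Finset.sum_congr rfl fun j _ => ?_
    rw [← X_pow_mul_fundCovariant hsm hsC]
    ring
  -- The last covariant does not involve i after the shift and takes degree 0; the others take
  -- degrees 1, …, r - 1.
  let v : Fin r → ℕ := fun j => if (j : ℕ) + 1 < r then j + 1 else 0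
  let w : Fin r → MvPolynomial (Fin r) ℂ := fun j =>
    if (j : ℕ) + 1 < r then 1 else (∏ l, X l) ^ (e * C)
  have hw : ∀ j, w j ≠ 0 := fun j => by
    simp only [w]
    split_ifs
    · exact one_ne_zero
    · exact pow_ne_zero _ (Finset.prod_ne_zero_iff.2 fun _ _ => X_ne_zero _)
  have hv : ∀ j, v j < r := fun j => by simp only [v]; split_ifs <;> omega
  have hvi : Function.Injective v := by
    intro j j' hjj
    simp only [v] at hjj
    ext
    split_ifs at hjj <;> omega
  have hvw : ∀ j i, shiftedCovariant r m e C j i = w j * (X i ^ m) ^ v j := by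
    intro j i
    simp only [shiftedCovariant, v, w]
    split_ifs
    · rw [one_mul, pow_mul]
    · rw [pow_zero, mul_one]
  let Q : Polynomial (MvPolynomial (Fin r) ℂ) := ∑ j, Polynomial.monomial (v j) (h j * w j)
  have hQ : Q = 0 := by
    refine Polynomial.eq_zero_of_natDegree_lt_card_of_eval_eq_zero Q
      (f := fun i : Fin r => (X i : MvPolynomial (Fin r) ℂ) ^ m) ?_ (fun i => ?_) ?_
    · intro i i' hii
      simp only [← expand_X] at hii
      exact X_injective (expand_injective hm0 hii)
    · rw [Polynomial.eval_finsetSum, ← h1 i]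
      refine Finset.sum_congr rfl fun j _ => ?_
      rw [Polynomial.eval_monomial, hvw, mul_assoc]
    · rw [Fintype.card_fin]
      have hr : Q.natDegree ≤ r - 1 :=
        Polynomial.natDegree_sum_le_of_forall_le _ _ fun j _ =>
          (Polynomial.natDegree_monomial_le _).trans (Nat.le_sub_one_of_lt (hv j))
      have := j.pos
      omega
  have hcoef := congrArg (fun P => Polynomial.coeff P (v j)) hQ
  simp only [Q, Polynomial.finsetSum_coeff, Polynomial.coeff_monomial, hvi.eq_iff,
    Polynomial.coeff_zero] at hcoef
  rw [Finset.sum_ite_eq' Finset.univ j, if_pos (Finset.mem_univ j)] at hcoef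
  exact (mul_eq_zero.1 hcoef).resolve_right (hw j)

theorem exists_coeff_of_covariant (hr : 1 ≤ r) (hm : m = q * e) (hq : 0 < q) (he : 0 < e)
    {ζ : ℂ} (hζ : IsPrimitiveRoot ζ m) (hsm : s ≤ m) (hsC : s ≤ e * C) (hC : C ≤ q)
    (hCs : ∀ c < C, e * c < s) {P : Fin r → MvPolynomial (Fin r) ℂ}
    (hP : ∀ g ∈ monomialGroup m q r, ∀ π θ, IsMonomial g π θ →
      ∀ i, polyRep r g (P i) = MvPolynomial.C (θ i ^ s) * P (π i)) :
    ∃ h : Fin r → MvPolynomial (Fin r) ℂ, (∀ j, h j ∈ invRing) ∧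
      ∀ i, P i = ∑ j, h j * fundCovariant r m e C s j i := by
  have hmem : (fun i => X i ^ s * P i) ∈ covModule := by
    refine mem_covModule hr hm hq he hζ hC hCs (fun g hgm π θ hg i => ?_) fun i k hk => ?_
    · rw [polyRep_mul_apply, hg.polyRep_X_pow, hP g hgm π θ hg]
      have hC1 : MvPolynomial.C (σ := Fin r) (θ i ^ s)⁻¹ * MvPolynomial.C (θ i ^ s) = 1 := by
        rw [← C_mul, inv_mul_cancel₀ (pow_ne_zero _ (hg.ne_zero i)), C_1]
      linear_combination (X (π i) ^ s * P (π i)) * hC1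
    · by_contra hlt
      refine hk ?_
      rw [X_pow_eq_monomial, coeff_monomial_mul', if_neg]
      intro hle
      have := hle i
      rw [Finsupp.single_eq_same] at this
      exact hlt this
  obtain ⟨h, hh⟩ := (Submodule.mem_span_range_iff_exists_fun _).1 hmem
  refine ⟨fun j => h j, fun j => (h j).2, fun i => ?_⟩
  refine mul_left_cancel₀ (pow_ne_zero s (X_ne_zero i)) ((congrFun hh i).symm.trans ?_)
  rw [Finset.sum_apply, Finset.mul_sum]
  refine Finset.sum_congr rfl fun j _ => ?_
  rw [Pi.smul_apply, Subalgebra.smul_def, smul_eq_mul, ← X_pow_mul_fundCovariant hsm hsC]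
  ring

end Covariants

/-! ### Linear parts and the independence of E from the generators -/

section LinearPart

variable {r : ℕ}

/-- The coefficients of the linear part of a polynomial. -/
def linearPart (r : ℕ) : MvPolynomial (Fin r) ℂ →ₗ[ℂ] Fin r → ℂ :=
  LinearMap.pi fun j => lcoeff ℂ 0 ∘ₗ ((pderiv j : Derivation ℂ (MvPolynomial (Fin r) ℂ) _) :
    MvPolynomial (Fin r) ℂ →ₗ[ℂ] MvPolynomial (Fin r) ℂ)

theorem linearPart_apply (P : MvPolynomial (Fin r) ℂ) (j : Fin r) :
    linearPart r P j = constantCoeff (pderiv j P) := rfl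

theorem linearPart_X (i j : Fin r) : linearPart r (X i) j = if i = j then 1 else 0 := by
  rw [linearPart_apply, pderiv_X, Pi.single_apply]
  split_ifs <;> simp

theorem constantCoeff_aeval {Φ : Fin r → MvPolynomial (Fin r) ℂ}
    (hΦ : ∀ k, constantCoeff (Φ k) = 0) (F : MvPolynomial (Fin r) ℂ) :
    constantCoeff (aeval Φ F) = constantCoeff F := by
  have : (constantCoeff : MvPolynomial (Fin r) ℂ →+* ℂ).comp (aeval Φ).toRingHom =
      constantCoeff := by
    refine ringHom_ext (fun c => ?_) fun i => ?_
    · simp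
    · simpa using hΦ i
  exact DFunLike.congr_fun this F

/-- This is the chain rule at the origin. -/
theorem linearPart_aeval {Φ : Fin r → MvPolynomial (Fin r) ℂ}
    (hΦ : ∀ k, constantCoeff (Φ k) = 0) (F : MvPolynomial (Fin r) ℂ) (j : Fin r) :
    linearPart r (aeval Φ F) j = ∑ k, linearPart r F k * linearPart r (Φ k) j := by
  induction F using MvPolynomial.induction_on with
  | C c => simp [linearPart_apply]
  | add P Q hP hQ =>
    simp only [map_add, Pi.add_apply, hP, hQ, add_mul, Finset.sum_add_distrib]
  | mul_X P i hP =>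
    simp only [linearPart_apply] at hP ⊢
    simp only [map_mul, aeval_X, pderiv_mul, map_add, hΦ, mul_zero, zero_add,
      constantCoeff_aeval hΦ, constantCoeff_X, pderiv_X, Pi.single_apply]
    simp [apply_ite, Finset.sum_ite_eq]

theorem constantCoeff_linSubst (A : Matrix (Fin r) (Fin r) ℂ) (P : MvPolynomial (Fin r) ℂ) :
    constantCoeff (linSubst A P) = constantCoeff P :=
  constantCoeff_aeval (by simp) P

end LinearPart

namespace IsStableInvariantSystem

variable {r : ℕ} {G : Subgroup (GL (Fin r) ℂ)} {N : Subgroup G}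
  {f f₀ : Fin r → MvPolynomial (Fin r) ℂ}

/-- Only degree 0 could contribute, and a constant is algebraic over ℂ, so it cannot belong to an
algebraically independent family. -/
theorem constantCoeff_eq_zero (hf : IsStableInvariantSystem N f) (i : Fin r) :
    constantCoeff (f i) = 0 := by
  obtain ⟨k, hk⟩ := hf.homogeneous i
  by_cases hk0 : k = 0
  · subst hk0
    have h := (totalDegree_zero_iff_isHomogeneous _).2 hk
    rw [totalDegree_eq_zero_iff_eq_C] at h
    have htr := hf.algebraicIndependent.transcendental i
    rw [h] at htr
    exact absurd (isAlgebraic_algebraMap _) htr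
  · exact hk.coeff_eq_zero (by simpa using Ne.symm hk0)

theorem mem_adjoin_of_mem_span {p : MvPolynomial (Fin r) ℂ}
    (hp : p ∈ Submodule.span ℂ (Set.range f)) : p ∈ Algebra.adjoin ℂ (Set.range f) :=
  Algebra.span_le_adjoin ℂ _ hp

theorem adjoin_eq (hf : IsStableInvariantSystem N f) (hf₀ : IsStableInvariantSystem N f₀) :
    Algebra.adjoin ℂ (Set.range f) = Algebra.adjoin ℂ (Set.range f₀) := by
  ext p
  rw [hf.mem_adjoin_iff, hf₀.mem_adjoin_iff]

/-- The linear part, with respect to `f₀`, of an element of the span of `f`. -/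
def linearPartMap (hf : IsStableInvariantSystem N f) (hf₀ : IsStableInvariantSystem N f₀) :
    Submodule.span ℂ (Set.range f) →ₗ[ℂ] Fin r → ℂ :=
  linearPart r ∘ₗ hf₀.algebraicIndependent.repr.toLinearMap ∘ₗ
    Submodule.inclusion (p' := Subalgebra.toSubmodule (Algebra.adjoin ℂ (Set.range f₀)))
      fun _ hp => hf.adjoin_eq hf₀ ▸ mem_adjoin_of_mem_span hp

theorem linearPartMap_apply (hf : IsStableInvariantSystem N f)
    (hf₀ : IsStableInvariantSystem N f₀) (p : Submodule.span ℂ (Set.range f))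
    {F : MvPolynomial (Fin r) ℂ} (hF : aeval f₀ F = (p : MvPolynomial (Fin r) ℂ)) :
    hf.linearPartMap hf₀ p = linearPart r F := by
  have hinj : Function.Injective (aeval f₀ : MvPolynomial (Fin r) ℂ →ₐ[ℂ] _) :=
    hf₀.algebraicIndependent
  change linearPart r (hf₀.algebraicIndependent.repr _) = _
  congr 1
  refine hinj ?_
  rw [hf₀.algebraicIndependent.aeval_repr, hF]
  rfl

/-- Both systems generate the same algebra, so the f₀ are polynomials Φ in the f. If the linear part
in the f₀ vanishes, the chain rule makes the linear part in the f vanish; but an element of the span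
of f equals its linear part there. -/
theorem linearPartMap_injective (hf : IsStableInvariantSystem N f)
    (hf₀ : IsStableInvariantSystem N f₀) : Function.Injective (hf.linearPartMap hf₀) := by
  rw [injective_iff_map_eq_zero]
  intro p hp
  have hex : ∀ {f f' : Fin r → MvPolynomial (Fin r) ℂ}, IsStableInvariantSystem N f →
      IsStableInvariantSystem N f' → ∀ {x}, x ∈ Submodule.span ℂ (Set.range f') →
      ∃ F : MvPolynomial (Fin r) ℂ, aeval f F = x := by
    intro f f' hf hf' x hx
    have h1 := hf'.adjoin_eq hf ▸ mem_adjoin_of_mem_span hx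
    rw [Algebra.adjoin_range_eq_range_aeval] at h1
    exact h1
  obtain ⟨F, hF⟩ := hex hf₀ hf p.2
  rw [hf.linearPartMap_apply hf₀ p hF] at hp
  choose Φ hΦ using fun k => hex hf hf₀ (Submodule.subset_span ⟨k, rfl⟩)
  have hΦ0 : ∀ k, constantCoeff (Φ k) = 0 := fun k => by
    rw [← constantCoeff_aeval hf.constantCoeff_eq_zero, hΦ, hf₀.constantCoeff_eq_zero]
  obtain ⟨v, hv⟩ := (Submodule.mem_span_range_iff_exists_fun ℂ).1 p.2
  have h1 : aeval f (aeval Φ F) = aeval f (∑ i, v i • X i : MvPolynomial (Fin r) ℂ) := by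
    rw [← AlgHom.comp_apply, comp_aeval]
    simp only [hΦ, map_sum, map_smul, aeval_X]
    rw [hF, hv]
  have h2 : aeval Φ F = ∑ i, v i • X i := hf.algebraicIndependent h1
  have hv0 : ∀ j, v j = 0 := by
    intro j
    have h3 := congrFun (congrArg (linearPart r) h2) j
    rw [linearPart_aeval hΦ0, hp] at h3
    simpa [linearPart_X] using h3.symm
  refine Subtype.ext ?_
  rw [← hv]
  simp [hv0]

/-- The span of any stable system of invariants is isomorphic, as a `G`-module, to the span of a
system on which `G` acts diagonally. -/
theorem exists_linearEquiv (hf : IsStableInvariantSystem N f)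
    (hf₀ : IsStableInvariantSystem N f₀) {χ : G → Fin r → ℂ}
    (hχ : ∀ (g : G) i, polyRep r g (f₀ i) = χ g i • f₀ i) :
    ∃ E : Submodule.span ℂ (Set.range f) ≃ₗ[ℂ] (Fin r → ℂ),
      ∀ g p, E (quotientSpaceDual hf g p) = χ g * E p := by
  have hfin : Module.finrank ℂ (Submodule.span ℂ (Set.range f)) = Module.finrank ℂ (Fin r → ℂ) := by
    rw [finrank_span_eq_card hf.algebraicIndependent.linearIndependent, Module.finrank_fin_fun,
      Fintype.card_fin]
  have : FiniteDimensional ℂ (Submodule.span ℂ (Set.range f)) :=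
    FiniteDimensional.span_of_finite ℂ (Set.finite_range f)
  refine ⟨LinearEquiv.ofInjectiveOfFinrankEq (hf.linearPartMap hf₀)
    (hf.linearPartMap_injective hf₀) hfin, fun g p => ?_⟩
  change hf.linearPartMap hf₀ _ = χ g * hf.linearPartMap hf₀ p
  have h1 := hf.adjoin_eq hf₀ ▸ mem_adjoin_of_mem_span p.2
  rw [Algebra.adjoin_range_eq_range_aeval] at h1
  obtain ⟨F, hF⟩ := h1
  -- As G acts on f₀ by scalars, it acts on polynomials in f₀ by rescaling the variables, and so on
  -- linear parts by the same scalars.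
  have h2 : aeval f₀ (scaleVars (χ g) F) =
      ((quotientSpaceDual hf g p : Submodule.span ℂ (Set.range f)) : MvPolynomial (Fin r) ℂ) := by
    have h3 : (aeval f₀).comp (scaleVars (χ g)) =
        (linSubst (g.1⁻¹).val).comp (aeval f₀ : MvPolynomial (Fin r) ℂ →ₐ[ℂ] _) := by
      refine algHom_ext fun i => ?_
      have := hχ g i
      rw [polyRep_apply, smul_eq_C_mul] at this
      simp only [AlgHom.comp_apply, aeval_X, this]
      simp [scaleVars]
    rw [← AlgHom.comp_apply, h3, AlgHom.comp_apply]
    exact congrArg (linSubst (g.1⁻¹).val) hF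
  rw [hf.linearPartMap_apply hf₀ _ h2, hf.linearPartMap_apply hf₀ p hF]
  funext j
  rw [scaleVars, linearPart_aeval (by simp), Finset.sum_eq_single j]
  · rw [← smul_eq_C_mul, map_smul, Pi.smul_apply, linearPart_X, if_pos rfl, Pi.mul_apply,
      smul_eq_mul, mul_one, mul_comm]
  · intro k _ hk
    rw [← smul_eq_C_mul, map_smul, Pi.smul_apply, linearPart_X, if_neg hk, smul_zero, mul_zero]
  · simp

end IsStableInvariantSystem

/-! ### Averaging over N and independence modulo the Hilbert ideal -/

section Average

variable {r m q e C s : ℕ}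

/-- The action of a monomial matrix on `S(V^*) ⊗ (V^σ)^*`, where `σ` raises roots of unity to the
`s`-th power, in coordinates. -/
def twistAct (s : ℕ) (g : GL (Fin r) ℂ) :
    (Fin r → MvPolynomial (Fin r) ℂ) →ₗ[ℂ] (Fin r → MvPolynomial (Fin r) ℂ) :=
  LinearMap.pi fun l => ∑ i, ((g⁻¹).val i l ^ s) • (polyRep r g ∘ₗ LinearMap.proj i)

theorem twistAct_apply (hs : s ≠ 0) {g : GL (Fin r) ℂ} {π : Equiv.Perm (Fin r)}
    {θ : Fin r → ℂ} (hg : IsMonomial g π θ) (P : Fin r → MvPolynomial (Fin r) ℂ) (i : Fin r) :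
    twistAct s g P (π i) = (θ i ^ s)⁻¹ • polyRep r g (P i) := by
  simp only [twistAct, LinearMap.pi_apply, LinearMap.sum_apply, LinearMap.smul_apply,
    LinearMap.comp_apply, LinearMap.proj_apply]
  rw [Finset.sum_eq_single i]
  · rw [hg.inv_apply, if_pos rfl, inv_pow]
  · intro k _ hk
    rw [hg.inv_apply, if_neg (fun h => hk (π.injective h).symm), zero_pow hs, zero_smul]
  · simp

theorem twistAct_mul (hs : s ≠ 0) {g h : GL (Fin r) ℂ} {π π' : Equiv.Perm (Fin r)}
    {θ θ' : Fin r → ℂ} (hg : IsMonomial g π θ) (hh : IsMonomial h π' θ')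
    (P : Fin r → MvPolynomial (Fin r) ℂ) :
    twistAct s (g * h) P = twistAct s g (twistAct s h P) := by
  funext l
  obtain ⟨i, rfl⟩ := (π * π').surjective l
  rw [twistAct_apply hs (hg.mul hh), Equiv.Perm.mul_apply, twistAct_apply hs hg,
    twistAct_apply hs hh, map_smul, smul_smul, map_mul, Module.End.mul_apply, mul_pow, mul_inv]

theorem twistAct_eq_self_iff (hs : s ≠ 0) {g : GL (Fin r) ℂ} {π : Equiv.Perm (Fin r)}
    {θ : Fin r → ℂ} (hg : IsMonomial g π θ) (P : Fin r → MvPolynomial (Fin r) ℂ) :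
    twistAct s g P = P ↔
      ∀ i, polyRep r g (P i) = MvPolynomial.C (θ i ^ s) * P (π i) := by
  have h : ∀ i, twistAct s g P (π i) = P (π i) ↔
      polyRep r g (P i) = MvPolynomial.C (θ i ^ s) * P (π i) := fun i => by
    rw [twistAct_apply hs hg, inv_smul_eq_iff₀ (pow_ne_zero s (hg.ne_zero i)), smul_eq_C_mul]
  rw [funext_iff, π.surjective.forall]
  exact forall_congr' h

theorem twistAct_mul_of_invariant {g : GL (Fin r) ℂ} {p : MvPolynomial (Fin r) ℂ}
    (hp : polyRep r g p = p) (P : Fin r → MvPolynomial (Fin r) ℂ) :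
    twistAct s g (fun i => p * P i) = fun i => p * twistAct s g P i := by
  funext l
  simp only [twistAct, LinearMap.pi_apply, LinearMap.sum_apply, LinearMap.smul_apply,
    LinearMap.comp_apply, LinearMap.proj_apply, polyRep_mul_apply, hp, Finset.mul_sum,
    mul_smul_comm]

/-- The sum over the group `G(m, q, r)` of the translates of a family. -/
def groupSum (s q : ℕ) (hm0 : 0 < m) :
    (Fin r → MvPolynomial (Fin r) ℂ) →ₗ[ℂ] (Fin r → MvPolynomial (Fin r) ℂ) :=
  ∑ g ∈ (finite_monomialGroup hm0 q r).toFinset, twistAct s g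

theorem groupSum_apply (hm0 : 0 < m) (P : Fin r → MvPolynomial (Fin r) ℂ) :
    groupSum s q hm0 P = ∑ g ∈ (finite_monomialGroup hm0 q r).toFinset, twistAct s g P := by
  rw [groupSum, LinearMap.sum_apply]

theorem twistAct_groupSum (hs : s ≠ 0) (hm0 : 0 < m) {g : GL (Fin r) ℂ}
    (hg : g ∈ monomialGroup m q r) (P : Fin r → MvPolynomial (Fin r) ℂ) :
    twistAct s g (groupSum s q hm0 P) = groupSum s q hm0 P := by
  rw [groupSum_apply, map_sum]
  refine Finset.sum_nbij' (g * ·) (g⁻¹ * ·) ?_ ?_ ?_ ?_ ?_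
  · intro h hh
    rw [Set.Finite.mem_toFinset] at hh ⊢
    exact mul_mem hg hh
  · intro h hh
    rw [Set.Finite.mem_toFinset] at hh ⊢
    exact mul_mem (inv_mem hg) hh
  · intro h _
    exact inv_mul_cancel_left g h
  · intro h _
    exact mul_inv_cancel_left g h
  · intro h hh
    rw [Set.Finite.mem_toFinset] at hh
    obtain ⟨π, θ, hg'⟩ := exists_isMonomial hg
    obtain ⟨π', θ', hh'⟩ := exists_isMonomial (SetLike.mem_coe.1 hh)
    exact (twistAct_mul hs hg' hh' P).symm

theorem groupSum_of_covariant (hm0 : 0 < m) {P : Fin r → MvPolynomial (Fin r) ℂ}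
    (hP : ∀ g ∈ monomialGroup m q r, twistAct s g P = P) :
    ∃ c : ℂ, c ≠ 0 ∧ groupSum s q hm0 P = c • P := by
  refine ⟨((finite_monomialGroup hm0 q r).toFinset.card : ℂ), ?_, ?_⟩
  · exact Nat.cast_ne_zero.2 (Finset.card_ne_zero_of_mem (a := 1)
      ((Set.Finite.mem_toFinset _).2 (one_mem (monomialGroup m q r))))
  · rw [groupSum_apply, Finset.sum_congr rfl fun g hg =>
      hP g ((Set.Finite.mem_toFinset _).1 hg), Finset.sum_const, Nat.cast_smul_eq_nsmul]

/-- The averages of families in the Hilbert ideal are combinations of the fundamental covariants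
whose coefficients are invariants without constant term. -/
theorem groupSum_mem_of_mem_invariantIdeal (hr : 1 ≤ r) (hm : m = q * e) (hq : 0 < q) (he : 0 < e)
    {ζ : ℂ} (hζ : IsPrimitiveRoot ζ m) (hs : s ≠ 0) (hsm : s ≤ m) (hsC : s ≤ e * C) (hC : C ≤ q)
    (hCs : ∀ c < C, e * c < s) (hm0 : 0 < m) {P : Fin r → MvPolynomial (Fin r) ℂ}
    (hP : ∀ i, P i ∈ invariantIdeal (monomialGroup m q r)) :
    ∃ h : Fin r → MvPolynomial (Fin r) ℂ, (∀ j, constantCoeff (h j) = 0) ∧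
      ∀ l, groupSum s q hm0 P l = ∑ j, h j * fundCovariant r m e C s j l := by
  have hadd : ∀ {P P' : Fin r → MvPolynomial (Fin r) ℂ},
      (∃ h : Fin r → MvPolynomial (Fin r) ℂ, (∀ j, constantCoeff (h j) = 0) ∧
        ∀ l, P l = ∑ j, h j * fundCovariant r m e C s j l) →
      (∃ h : Fin r → MvPolynomial (Fin r) ℂ, (∀ j, constantCoeff (h j) = 0) ∧
        ∀ l, P' l = ∑ j, h j * fundCovariant r m e C s j l) →
      ∃ h : Fin r → MvPolynomial (Fin r) ℂ, (∀ j, constantCoeff (h j) = 0) ∧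
        ∀ l, (P + P') l = ∑ j, h j * fundCovariant r m e C s j l := by
    rintro P P' ⟨h, hh, hP⟩ ⟨h', hh', hP'⟩
    refine ⟨h + h', fun j => by rw [Pi.add_apply, map_add, hh, hh', add_zero], fun l => ?_⟩
    rw [Pi.add_apply, hP, hP', ← Finset.sum_add_distrib]
    exact Finset.sum_congr rfl fun j _ => (add_mul _ _ _).symm
  have hzero : ∃ h : Fin r → MvPolynomial (Fin r) ℂ, (∀ j, constantCoeff (h j) = 0) ∧
      ∀ l, (0 : Fin r → MvPolynomial (Fin r) ℂ) l = ∑ j, h j * fundCovariant r m e C s j l :=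
    ⟨0, by simp, by simp⟩
  -- For an invariant p, averaging a family p·a gives p times the average of a, which is a
  -- combination of the covariants; its coefficients acquire the factor p and lose their constant
  -- terms. The arbitrary factor a absorbs ring multiplication in the induction on the ideal.
  have hsingle : ∀ i, ∀ f ∈ invariantIdeal (monomialGroup m q r), ∀ a,
      ∃ h : Fin r → MvPolynomial (Fin r) ℂ, (∀ j, constantCoeff (h j) = 0) ∧
        ∀ l, groupSum s q hm0 (Pi.single i (a * f)) l =
          ∑ j, h j * fundCovariant r m e C s j l := by
    intro i f hf
    induction hf using Submodule.span_induction with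
    | mem p hp =>
      intro a
      obtain ⟨h, -, hh⟩ := exists_coeff_of_covariant hr hm hq he hζ hsm hsC hC hCs
        (P := groupSum s q hm0 (Pi.single i a)) fun g hgm π θ hg =>
          (twistAct_eq_self_iff hs hg _).1 (twistAct_groupSum hs hm0 hgm _)
      refine ⟨fun j => p * h j, fun j => by rw [map_mul, hp.2, zero_mul], fun l => ?_⟩
      have h1 : (Pi.single i (a * p) : Fin r → MvPolynomial (Fin r) ℂ) =
          fun k => p * (Pi.single i a : Fin r → MvPolynomial (Fin r) ℂ) k := by
        funext k
        by_cases hk : k = i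
        · subst hk; simp [mul_comm]
        · simp [hk]
      have h2 : groupSum s q hm0 (Pi.single i (a * p)) l =
          p * groupSum s q hm0 (Pi.single i a) l := by
        rw [h1, groupSum_apply, groupSum_apply, Finset.sum_congr rfl fun g hg =>
          twistAct_mul_of_invariant (hp.1 g ((Set.Finite.mem_toFinset _).1 hg)) _,
          Finset.sum_apply, Finset.sum_apply, Finset.mul_sum]
      rw [h2, hh, Finset.mul_sum]
      exact Finset.sum_congr rfl fun j _ => (mul_assoc _ _ _).symm
    | zero =>
      intro a
      rw [mul_zero, Pi.single_zero, map_zero]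
      exact hzero
    | add x y _ _ hx hy =>
      intro a
      rw [mul_add, Pi.single_add, map_add]
      exact hadd (hx a) (hy a)
    | smul c x _ hx =>
      intro a
      rw [smul_eq_mul, ← mul_assoc]
      exact hx _
  have hsum : P = ∑ i, Pi.single i (1 * P i) := by
    simp only [one_mul]
    exact (Finset.univ_sum_single P).symm
  rw [hsum, map_sum]
  exact Finset.sum_induction _ (fun Q : Fin r → MvPolynomial (Fin r) ℂ =>
    ∃ h : Fin r → MvPolynomial (Fin r) ℂ, (∀ j, constantCoeff (h j) = 0) ∧
      ∀ l, Q l = ∑ j, h j * fundCovariant r m e C s j l) (fun _ _ => hadd) hzero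
    fun i _ => hsingle i _ (hP i) 1

theorem stdChar_eq_one {z : ℂ} (hz : z ^ e = 1) (j : Fin r) : stdChar e z j = 1 := by
  simp [stdChar, hz]

theorem stdChar_of_mem (hm : m = q * e) (hq : 0 < q) {g : GL (Fin r) ℂ}
    (hg : g ∈ monomialGroup m q r) (n : ℕ) (j : Fin r) : stdChar e (entryProd g ^ n) j = 1 := by
  have hmq : m / q = e := by rw [hm, Nat.mul_div_cancel_left _ hq]
  obtain ⟨π, θ, h⟩ := exists_isMonomial hg
  have h2 := (h.mem_monomialGroup_iff.1 hg).2
  rw [hmq, ← h.entryProd_eq] at h2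
  exact stdChar_eq_one (by rw [← pow_mul, mul_comm, pow_mul, h2, one_pow]) j

/-- The fundamental covariants are linearly independent modulo the Hilbert ideal. -/
theorem fundCovariant_independent_mod (hr : 1 ≤ r) (hm : m = q * e) (hq : 0 < q) (he : 0 < e)
    {ζ : ℂ} (hζ : IsPrimitiveRoot ζ m) (hs : s ≠ 0) (hsm : s ≤ m) (hsC : s ≤ e * C) (hC : C ≤ q)
    (hCs : ∀ c < C, e * c < s) {v : Fin r → ℂ}
    (hv : ∀ i, ∑ j, v j • fundCovariant r m e C s j i ∈ invariantIdeal (monomialGroup m q r)) :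
    v = 0 := by
  have hm0 : 0 < m := hm ▸ Nat.mul_pos hq he
  let P : Fin r → MvPolynomial (Fin r) ℂ := fun i => ∑ j, v j • fundCovariant r m e C s j i
  obtain ⟨c, hc, hcP⟩ := groupSum_of_covariant (s := s) (q := q) hm0 (P := P) fun g hgm => by
    obtain ⟨π, θ, hg⟩ := exists_isMonomial hgm
    rw [twistAct_eq_self_iff hs hg]
    intro i
    rw [map_sum, Finset.mul_sum]
    refine Finset.sum_congr rfl fun j _ => ?_
    rw [map_smul, polyRep_fundCovariant hsm hsC hgm hg, stdChar_of_mem hm hq hgm, one_smul,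
      mul_smul_comm]
  obtain ⟨h, hh, hP⟩ := groupSum_mem_of_mem_invariantIdeal hr hm hq he hζ hs hsm hsC hC hCs hm0 hv
  -- The average of P is c P, and it is also a combination with coefficients h_j free of constant
  -- terms. By independence over the polynomial ring, h_j = c v_j, whence v_j = 0.
  have key := fundCovariant_linearIndependent (h := fun j => h j - MvPolynomial.C (c * v j))
    hm0 hsm hsC fun i => by
      have h1 := hP i
      change groupSum s q hm0 P i = _ at h1
      rw [hcP] at h1
      simp only [sub_mul, Finset.sum_sub_distrib]
      rw [← h1, sub_eq_zero, Pi.smul_apply, Finset.smul_sum]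
      refine Finset.sum_congr rfl fun j _ => ?_
      rw [smul_smul, smul_eq_C_mul]
  funext j
  have h1 := congrArg constantCoeff (key j)
  rw [map_sub, hh, constantCoeff_C, zero_sub, map_zero, neg_eq_zero] at h1
  exact (mul_eq_zero.1 h1).resolve_left hc

end Average

/-! ### Tensors with the dual of ℂ^r as families -/

open scoped TensorProduct

section Tensor

variable {r : ℕ} {V : Type*} [AddCommGroup V] [Module ℂ V]

/-- Elements of `V ⊗ (ℂ^r)^*` as families of elements of `V`. -/
def tensorDualEquiv (r : ℕ) (V : Type*) [AddCommGroup V] [Module ℂ V] :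
    V ⊗[ℂ] Module.Dual ℂ (Fin r → ℂ) ≃ₗ[ℂ] (Fin r → V) :=
  TensorProduct.equivFinsuppOfBasisRight (Pi.basisFun ℂ (Fin r)).dualBasis ≪≫ₗ
    Finsupp.linearEquivFunOnFinite ℂ V (Fin r)

theorem dualBasis_basisFun (i : Fin r) :
    (Pi.basisFun ℂ (Fin r)).dualBasis i = LinearMap.proj i := by
  refine LinearMap.ext fun v => ?_
  simp

theorem tensorDualEquiv_symm_apply (F : Fin r → V) :
    (tensorDualEquiv r V).symm F = ∑ i, F i ⊗ₜ[ℂ] (LinearMap.proj i : Module.Dual ℂ (Fin r → ℂ)) := by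
  rw [LinearEquiv.symm_apply_eq, map_sum]
  funext k
  rw [Finset.sum_apply, Finset.sum_eq_single k]
  · rw [← dualBasis_basisFun]
    simp [tensorDualEquiv]
  · intro i _ hi
    rw [← dualBasis_basisFun]
    simp [tensorDualEquiv, hi]
  · simp

end Tensor

/-! ### Transfer to the harmonic polynomials and conclusion -/

section Main

variable {r m q e C s p : ℕ}

/-- The subgroup `G(m, q, r)` of `G(m, p, r)`. -/
abbrev relGroup (m q p r : ℕ) : Subgroup (monomialGroup m p r) :=
  (monomialGroup m q r).subgroupOf (monomialGroup m p r)

theorem polyRep_mem_invariantIdeal [hN : (relGroup m q p r).Normal]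
    (hle : monomialGroup m q r ≤ monomialGroup m p r) (g : monomialGroup m p r)
    {f : MvPolynomial (Fin r) ℂ} (hf : f ∈ invariantIdeal (monomialGroup m q r)) :
    polyRep r g f ∈ invariantIdeal (monomialGroup m q r) := by
  have : invariantIdeal (monomialGroup m q r) ≤
      (invariantIdeal (monomialGroup m q r)).comap (linSubst (g.1⁻¹).val) := by
    refine Ideal.span_le.2 ?_
    rintro P ⟨hP, hP0⟩
    refine Ideal.subset_span ⟨fun n hn => ?_, by rw [constantCoeff_linSubst, hP0]⟩
    have hmul : (n : GL (Fin r) ℂ) * g = g * (g⁻¹ * ⟨n, hle hn⟩ * g : monomialGroup m p r) := by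
      simp [mul_assoc]
    change polyRep r n (polyRep r g P) = polyRep r g P
    rw [← Module.End.mul_apply, ← map_mul, hmul, map_mul, Module.End.mul_apply]
    exact congrArg (polyRep r g) (hP _ (hN.conj_mem' ⟨n, hle hn⟩ hn g))
  exact this hf

/-- The projection onto the harmonic polynomials along the Hilbert ideal. -/
def harmonicProj (hm0 : 0 < m) (hle : monomialGroup m q r ≤ monomialGroup m p r) :
    MvPolynomial (Fin r) ℂ →ₗ[ℂ] harmonicPoly (relGroup m q p r) :=
  Submodule.projectionOnto _ _ (isCompl_invariantIdeal hm0 hle)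

theorem harmonicProj_eq_zero_iff (hm0 : 0 < m) (hle : monomialGroup m q r ≤ monomialGroup m p r)
    {f : MvPolynomial (Fin r) ℂ} :
    harmonicProj hm0 hle f = 0 ↔ f ∈ invariantIdeal (monomialGroup m q r) :=
  Submodule.projectionOnto_apply_eq_zero_iff (isCompl_invariantIdeal hm0 hle)

theorem harmonicProj_apply_coe (hm0 : 0 < m) (hle : monomialGroup m q r ≤ monomialGroup m p r)
    (f : harmonicPoly (relGroup m q p r)) : harmonicProj hm0 hle f = f :=
  Submodule.projectionOnto_apply_left (isCompl_invariantIdeal hm0 hle) f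

/-- Both summands are G-stable, the ideal because normality of N lets G act on the N-invariants. -/
theorem harmonicProj_polyRep [(relGroup m q p r).Normal] (hm0 : 0 < m)
    (hle : monomialGroup m q r ≤ monomialGroup m p r) (g : monomialGroup m p r)
    (f : MvPolynomial (Fin r) ℂ) :
    harmonicProj hm0 hle (polyRep r g f) =
      harmonicRep (relGroup m q p r) g (harmonicProj hm0 hle f) := by
  have h1 : f - harmonicProj hm0 hle f ∈ invariantIdeal (monomialGroup m q r) := by
    rw [← harmonicProj_eq_zero_iff hm0 hle, map_sub, harmonicProj_apply_coe, sub_self]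
  have h2 := (harmonicProj_eq_zero_iff hm0 hle).2 (polyRep_mem_invariantIdeal hle g h1)
  rw [map_sub, map_sub, sub_eq_zero] at h2
  rw [h2]
  exact harmonicProj_apply_coe hm0 hle
    (harmonicRep (relGroup m q p r) g (harmonicProj hm0 hle f))

theorem tprod_tensorDualEquiv_symm [(relGroup m q p r).Normal]
    {ρ : Representation ℂ (monomialGroup m p r) (Fin r → ℂ)} {g : monomialGroup m p r}
    {π : Equiv.Perm (Fin r)} {θ : Fin r → ℂ}
    (hρ : ∀ i, ρ.dual g (LinearMap.proj i) =
      (θ i ^ s)⁻¹ • (LinearMap.proj (π i) : Module.Dual ℂ (Fin r → ℂ)))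
    {F F' : Fin r → harmonicPoly (relGroup m q p r)}
    (hF : ∀ i, F' (π i) = (θ i ^ s)⁻¹ • harmonicRep (relGroup m q p r) g (F i)) :
    (harmonicRep (relGroup m q p r)).tprod ρ.dual g ((tensorDualEquiv r _).symm F) =
      (tensorDualEquiv r _).symm F' := by
  rw [tensorDualEquiv_symm_apply, tensorDualEquiv_symm_apply, map_sum, ← Equiv.sum_comp π (fun i => F' i ⊗ₜ[ℂ] _)]
  refine Finset.sum_congr rfl fun i _ => ?_
  rw [Representation.tprod_apply, TensorProduct.map_tmul, hρ, hF, TensorProduct.smul_tmul]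

/-- The linear combinations of the fundamental covariants, projected to the harmonic
polynomials. -/
def covariantMap (e C s : ℕ) (hm0 : 0 < m) (hle : monomialGroup m q r ≤ monomialGroup m p r) :
    (Fin r → ℂ) →ₗ[ℂ]
      harmonicPoly (relGroup m q p r) ⊗[ℂ] Module.Dual ℂ (Fin r → ℂ) :=
  (tensorDualEquiv r _).symm.toLinearMap ∘ₗ LinearMap.pi fun i =>
    harmonicProj hm0 hle ∘ₗ ∑ j, (LinearMap.proj j).smulRight (fundCovariant r m e C s j i)

theorem covariantMap_apply (hm0 : 0 < m) (hle : monomialGroup m q r ≤ monomialGroup m p r)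
    (v : Fin r → ℂ) :
    covariantMap e C s hm0 hle v = (tensorDualEquiv r _).symm fun i =>
      harmonicProj hm0 hle (∑ j, v j • fundCovariant r m e C s j i) := by
  simp [covariantMap, LinearMap.pi]

theorem tprod_covariantMap [(relGroup m q p r).Normal] (hm0 : 0 < m)
    (hle : monomialGroup m q r ≤ monomialGroup m p r) (hsm : s ≤ m) (hsC : s ≤ e * C)
    {ρ : Representation ℂ (monomialGroup m p r) (Fin r → ℂ)}
    (hρ : ∀ (g : monomialGroup m p r) π θ, IsMonomial g.1 π θ → ∀ i,
      ρ.dual g (LinearMap.proj i) =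
        (θ i ^ s)⁻¹ • (LinearMap.proj (π i) : Module.Dual ℂ (Fin r → ℂ)))
    (g : monomialGroup m p r) (v : Fin r → ℂ) :
    (harmonicRep (relGroup m q p r)).tprod ρ.dual g (covariantMap e C s hm0 hle v) =
      covariantMap e C s hm0 hle (stdChar e (entryProd g.1 ^ C) * v) := by
  obtain ⟨π, θ, hg⟩ := exists_isMonomial g.2
  rw [covariantMap_apply, covariantMap_apply]
  refine tprod_tensorDualEquiv_symm (hρ g π θ hg) fun i => ?_
  rw [← harmonicProj_polyRep, ← map_smul]
  congr 1
  rw [map_sum, Finset.smul_sum]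
  refine Finset.sum_congr rfl fun j _ => ?_
  rw [map_smul, polyRep_fundCovariant hsm hsC g.2 hg, ← smul_eq_C_mul, smul_comm (v j),
    inv_smul_smul₀ (pow_ne_zero s (hg.ne_zero i)), Pi.mul_apply, smul_smul, mul_comm]

/-- Injectivity is independence modulo the Hilbert ideal. For surjectivity, an invariant tensor is a
covariant family, hence a combination of the fundamental covariants over the invariants; modulo the
ideal each coefficient may be replaced by its constant term, and projection fixes harmonic members.
-/
theorem exists_equiv_orlikSolomonInvariants [(relGroup m q p r).Normal] (hr : 1 ≤ r)
    (hm : m = q * e) (hq : 0 < q) (he : 0 < e)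
    {ζ : ℂ} (hζ : IsPrimitiveRoot ζ m) (hs : s ≠ 0) (hsm : s ≤ m) (hsC : s ≤ e * C) (hC : C ≤ q)
    (hCs : ∀ c < C, e * c < s) (hle : monomialGroup m q r ≤ monomialGroup m p r)
    {ρ : Representation ℂ (monomialGroup m p r) (Fin r → ℂ)}
    (hρ : ∀ (g : monomialGroup m p r) π θ, IsMonomial g.1 π θ → ∀ i,
      ρ.dual g (LinearMap.proj i) =
        (θ i ^ s)⁻¹ • (LinearMap.proj (π i) : Module.Dual ℂ (Fin r → ℂ))) :
    ∃ E : (Fin r → ℂ) ≃ₗ[ℂ] orlikSolomonInvariants (relGroup m q p r) ρ,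
      ∀ g v, orlikSolomonDual (relGroup m q p r) ρ g (E v) =
        E (stdChar e (entryProd g.1 ^ C) * v) := by
  have hm0 : 0 < m := hm ▸ Nat.mul_pos hq he
  have hmem : ∀ v, covariantMap e C s hm0 hle v ∈
      orlikSolomonInvariants (relGroup m q p r) ρ := fun v n hn => by
    rw [tprod_covariantMap hm0 hle hsm hsC hρ]
    congr 1
    funext j
    rw [Pi.mul_apply, stdChar_of_mem hm hq (g := n.1) hn, one_mul]
  refine ⟨LinearEquiv.ofBijective ((covariantMap e C s hm0 hle).codRestrict _ hmem) ⟨?_, ?_⟩,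
    fun g v => Subtype.ext (tprod_covariantMap hm0 hle hsm hsC hρ g v)⟩
  · rw [injective_iff_map_eq_zero]
    intro v hv
    have h1 : covariantMap e C s hm0 hle v = 0 := congrArg Subtype.val hv
    rw [covariantMap_apply, LinearEquiv.map_eq_zero_iff] at h1
    exact fundCovariant_independent_mod hr hm hq he hζ hs hsm hsC hC hCs fun i =>
      (harmonicProj_eq_zero_iff hm0 hle).1 (congrFun h1 i)
  · rintro ⟨x, hx⟩
    obtain ⟨F, rfl⟩ := (tensorDualEquiv r _).symm.surjective x
    have hcov : ∀ g ∈ monomialGroup m q r, ∀ π θ, IsMonomial g π θ → ∀ i,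
        polyRep r g (F i : MvPolynomial (Fin r) ℂ) =
          MvPolynomial.C (θ i ^ s) * (F (π i) : MvPolynomial (Fin r) ℂ) := by
      intro g hgm π θ hg i
      have h1 := hx ⟨g, hle hgm⟩ hgm
      rw [tprod_tensorDualEquiv_symm (hρ ⟨g, hle hgm⟩ π θ hg) (F' := fun l =>
        (θ (π.symm l) ^ s)⁻¹ • harmonicRep (relGroup m q p r) ⟨g, hle hgm⟩ (F (π.symm l)))
        fun i => by simp] at h1
      have h2 := congrFun ((tensorDualEquiv r _).symm.injective h1) (π i)
      simp only [Equiv.symm_apply_apply] at h2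
      rw [inv_smul_eq_iff₀ (pow_ne_zero s (hg.ne_zero i))] at h2
      rw [← smul_eq_C_mul]
      exact congrArg Subtype.val h2
    obtain ⟨h, hh, hF⟩ := exists_coeff_of_covariant hr hm hq he hζ hsm hsC hC hCs hcov
    refine ⟨fun j => constantCoeff (h j), Subtype.ext ?_⟩
    change covariantMap e C s hm0 hle _ = _
    rw [covariantMap_apply]
    congr 1
    funext i
    rw [← harmonicProj_apply_coe hm0 hle (F i), hF i, ← sub_eq_zero, ← map_sub,
      harmonicProj_eq_zero_iff, ← Finset.sum_sub_distrib]
    refine Ideal.sum_mem _ fun j _ => ?_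
    rw [smul_eq_C_mul, ← sub_mul]
    refine Ideal.mul_mem_right _ _ (Ideal.subset_span ⟨fun n hn => ?_, by simp⟩)
    rw [map_sub, polyRep_C, invariant_of_mem_adjoin hm hq (hh j) hn]

/-- A Galois automorphism raises roots of unity to a fixed power. -/
theorem coe_algEquiv_eq_pow {ζ : ℂ} (hζ : IsPrimitiveRoot ζ m) (hm0 : 0 < m)
    {σ : IntermediateField.adjoin ℚ {ζ} ≃ₐ[ℚ] IntermediateField.adjoin ℚ {ζ}}
    (hσ : (σ (IntermediateField.AdjoinSimple.gen ℚ ζ) : ℂ) = ζ ^ s)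
    {z : IntermediateField.adjoin ℚ {ζ}} (hz : (z : ℂ) ^ m = 1) : (σ z : ℂ) = (z : ℂ) ^ s := by
  have : NeZero m := ⟨hm0.ne'⟩
  obtain ⟨k, -, hk⟩ := hζ.eq_pow_of_pow_eq_one hz
  have hz' : z = IntermediateField.AdjoinSimple.gen ℚ ζ ^ k := Subtype.ext (by simp [hk])
  rw [hz', map_pow, SubmonoidClass.coe_pow, hσ, SubmonoidClass.coe_pow,
    IntermediateField.AdjoinSimple.coe_gen, ← pow_mul, ← pow_mul, mul_comm]

/-- The i-th row of g⁻¹ has the single nonzero entry θ_i⁻¹, in column π(i), and σ raises this root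
of unity to the power s. -/
theorem galoisTwist_dual_proj {ζ : ℂ} (hζ : IsPrimitiveRoot ζ m) (hm0 : 0 < m)
    {σ : IntermediateField.adjoin ℚ {ζ} ≃ₐ[ℚ] IntermediateField.adjoin ℚ {ζ}}
    (hσ : (σ (IntermediateField.AdjoinSimple.gen ℚ ζ) : ℂ) = ζ ^ s)
    (g : monomialGroup m p r) (π : Equiv.Perm (Fin r)) (θ : Fin r → ℂ) (hg : IsMonomial g.1 π θ)
    (i : Fin r) :
    (galoisTwist (monomialGroup m p r) (IntermediateField.adjoin ℚ {ζ})
      (monomialGroup_entry_mem hm0 hζ) σ).dual g (LinearMap.proj i) =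
        (θ i ^ s)⁻¹ • (LinearMap.proj (π i) : Module.Dual ℂ (Fin r → ℂ)) := by
  refine LinearMap.ext fun v => ?_
  change (Matrix.toLin' _ v) i = (θ i ^ s)⁻¹ * v (π i)
  rw [Matrix.toLin'_apply, Matrix.mulVec, dotProduct, Finset.sum_eq_single (π i)]
  · rw [Matrix.of_apply]
    have hent : (g⁻¹).1.val i (π i) = (θ i)⁻¹ := by
      have := hg.inv_apply i (π i)
      rwa [if_pos rfl] at this
    rw [coe_algEquiv_eq_pow hζ hm0 hσ]
    · simp only [hent, inv_pow]
    · simp only [hent, inv_pow, (hg.mem_monomialGroup_iff.1 g.2).1, inv_one]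
  · intro j _ hj
    rw [Matrix.of_apply]
    have hent : (g⁻¹).1.val i j = 0 := by
      have := hg.inv_apply i j
      rwa [if_neg hj] at this
    have h0 : (⟨(g⁻¹).1.val i j, monomialGroup_entry_mem hm0 hζ _ (g⁻¹).2 i j⟩ :
        IntermediateField.adjoin ℚ {ζ}) = 0 := Subtype.ext hent
    rw [h0]
    simp
  · simp

theorem nonempty_orlikSolomon_equiv [(relGroup m q p r).Normal] (hr : 1 ≤ r)
    (hm : m = q * e) (hq : 0 < q) (he : 0 < e)
    {ζ : ℂ} (hζ : IsPrimitiveRoot ζ m) (hs : s ≠ 0) (hsm : s ≤ m)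
    (hle : monomialGroup m q r ≤ monomialGroup m p r)
    {ρ : Representation ℂ (monomialGroup m p r) (Fin r → ℂ)}
    (hρ : ∀ (g : monomialGroup m p r) π θ, IsMonomial g.1 π θ → ∀ i,
      ρ.dual g (LinearMap.proj i) =
        (θ i ^ s)⁻¹ • (LinearMap.proj (π i) : Module.Dual ℂ (Fin r → ℂ)))
    {f : Fin r → MvPolynomial (Fin r) ℂ} (hf : IsStableInvariantSystem (relGroup m q p r) f) :
    Nonempty ((orlikSolomon (relGroup m q p r) ρ).Equiv
      (fakeTensorPower (quotientSpace hf) ⌈(s : ℚ) / (e : ℚ)⌉)) := by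
  have heQ : (0 : ℚ) < e := Nat.cast_pos.2 he
  have hceil : ⌈(s : ℚ) / (e : ℚ)⌉ = ((⌈(s : ℚ) / (e : ℚ)⌉₊ : ℕ) : ℤ) :=
    (Int.natCast_ceil_eq_ceil (by positivity)).symm
  set C := ⌈(s : ℚ) / (e : ℚ)⌉₊ with hCdef
  -- The choice of C as a ceiling is used through three facts: s ≤ eC, C ≤ q (from s ≤ m = qe), and
  -- ec < s for every c < C.
  have hsC : s ≤ e * C := by
    have := (div_le_iff₀' heQ).1 (Nat.le_ceil ((s : ℚ) / (e : ℚ)))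
    exact_mod_cast this
  have hC : C ≤ q := by
    rw [hCdef, Nat.ceil_le, div_le_iff₀ heQ]
    exact_mod_cast hm ▸ hsm
  have hCs : ∀ c < C, e * c < s := fun c hc => by
    have := (lt_div_iff₀' heQ).1 (Nat.lt_ceil.1 hc)
    exact_mod_cast this
  obtain ⟨E₂, hE₂⟩ := exists_equiv_orlikSolomonInvariants hr hm hq he hζ hs hsm hsC hC hCs hle hρ
  obtain ⟨E₁, hE₁⟩ := hf.exists_linearEquiv
    (isStableInvariantSystem_stdInvariant hr hm hq he hζ hle)
    (χ := fun g => stdChar e (entryProd g.1)) fun g i => polyRep_stdInvariant g.2 i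
  -- Both sides are diagonal with the same characters, since the entry product of μ_C(g) is the C-th
  -- power of that of g.
  have key : ∀ g x, E₂ (E₁ (quotientSpaceDual hf (fakePow m p r C g) x)) =
      orlikSolomonDual (relGroup m q p r) ρ g (E₂ (E₁ x)) := by
    intro g x
    rw [hE₁, hE₂]
    have h1 : entryProd (fakePow m p r C g).1 = entryProd g.1 ^ C := by
      have := entryProdHom_fakePow (C : ℤ) g
      rwa [zpow_natCast] at this
    rw [h1]
  rw [hceil]
  refine ⟨Representation.Equiv.mk (E₁.trans E₂).dualMap fun g => ?_⟩
  refine LinearMap.ext fun φ => LinearMap.ext fun x => ?_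
  change φ (orlikSolomonDual (relGroup m q p r) ρ g⁻¹ (E₂ (E₁ x))) =
    φ (E₂ (E₁ (quotientSpaceDual hf (fakePow m p r C g)⁻¹ x)))
  rw [← map_inv, key]

end Main

theorem mainTheorem10 (r a b d e : ℕ) (hr : 1 ≤ r) (ha : 0 < a) (hb : 0 < b) (hde : a = d * e)
    (ζ : ℂ) (hζ : IsPrimitiveRoot ζ (a * b)) (s : ℕ) (hs : 1 ≤ s) (hsab : s < a * b)
    (hgcd : Nat.gcd s (a * b) = 1)
    (σ : IntermediateField.adjoin ℚ {ζ} ≃ₐ[ℚ] IntermediateField.adjoin ℚ {ζ})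
    (hσ : (σ (IntermediateField.AdjoinSimple.gen ℚ ζ) : ℂ) = ζ ^ s) :
    monomialGroup (a * b) (d * b) r ≤ monomialGroup (a * b) b r ∧
    ∃ _ : (innerGroup a b d r).Normal,
      Nonempty (monomialGroup (a * b) b r ⧸ innerGroup a b d r ≃* Multiplicative (ZMod d)) ∧
      (∃ f, IsStableInvariantSystem (innerGroup a b d r) f) ∧
      ∀ (f : Fin r → MvPolynomial (Fin r) ℂ)
        (hf : IsStableInvariantSystem (innerGroup a b d r) f),
        Nonempty ((orlikSolomon (innerGroup a b d r)
            (galoisTwist (monomialGroup (a * b) b r) (IntermediateField.adjoin ℚ {ζ})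
              (monomialGroup_entry_mem (Nat.mul_pos ha hb) hζ) σ)).Equiv
          (fakeTensorPower (quotientSpace hf) ⌈(s : ℚ) / (e : ℚ)⌉)) := by
  subst hde
  have hd : 0 < d := Nat.pos_of_mul_pos_right ha
  have he : 0 < e := Nat.pos_of_mul_pos_left ha
  -- With q = db the quotient m/q is e, so the general results for G(m, q, r) apply to N.
  have hm : d * e * b = d * b * e := by ring
  have hq : 0 < d * b := Nat.mul_pos hd hb
  have hle := monomialGroup_le (e := e) (r := r) hd hb
  have hN : (innerGroup (d * e) b d r).Normal := innerGroup_normal hd hb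
  refine ⟨hle, hN, nonempty_quotient_mulEquiv hr hd he hb,
    ⟨_, isStableInvariantSystem_stdInvariant hr hm hq he hζ hle⟩, fun f hf => ?_⟩
  exact nonempty_orlikSolomon_equiv hr hm hq he hζ (Nat.one_le_iff_ne_zero.1 hs) hsab.le hle
    (galoisTwist_dual_proj hζ (Nat.mul_pos ha hb) hσ) hf

end
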